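/- Throughout, a theory is a set of sentences of a first-order (one-sorted) language, and structures are nonempty. A theory $T$ is NIP if no formula $\varphi(x;y)$ has the independence property in a model of $T$ (there are no $M\models T$ and $(a_i)_{i\in\mathbb N}$, $(b_S)_{S\subseteq\mathbb N}$ in $M$ with $M\models\varphi(a_i,b_S)\iff i\in S$). It is unstable if some $\varphi(x;y)$ has the order property in a model of $T$ (there are $(a_i)_{i\in\mathbb N},(b_j)_{j\in\mathbb N}$ with $M\models\varphi(a_i,b_j)\iff i<j$). It has SOP if some $\varphi(x;y)$ has the strict order property in a model $M$ of $T$ (there are $(b_i)_{i\in\mathbb N}$ with $\varphi(M,b_i)\subsetneq\varphi(M,b_j)$ for $i<j$). A structure $M$ interprets a structure $N$ (with parameters) if there are $n$, a definable $X\subseteq M^n$ and a surjection $f\colon X\to N$ such that the preimages under $f$ of equality, of all basic relations and of the graphs of all basic functions of $N$ are definable in $M$, where definability allows parameters from $M$. The theory $T$ interprets an infinite linear order if some model of $T$ interprets an infinite linear order $(K,\leq)$. Let $\mathfrak C$ be a monster model of a complete theory, i.e. a $\kappa$-saturated and strongly $\kappa$-homogeneous model with $\kappa$ larger than $\aleph_0$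 and than the cardinality of the language; a tuple is small if its length is less than $\kappa$. For small tuples $a,b$ of the same length write $d_L(a,b)\leq n$ if there are $a=a_0,a_1,\dots,a_n=b$ and $M_1,\dots,M_n\preceq\mathfrak C$ such that $\operatorname{tp}(a_{i-1}/M_i)=\operatorname{tp}(a_i/M_i)$ for $i=1,\dots,n$, and $d_L(a,b)<\infty$ if this holds for some $n\in\mathbb N$. The complete theory is G-compact if for every small tuple $a$ in $\mathfrak C$ there is $n\in\mathbb N$ such that for all $b$, $d_L(a,b)<\infty$ implies $d_L(a,b)\leq n$ (this does not depend on the choice of $\mathfrak C$). A theory $T$ is hereditarily G-compact if for every model $M\models T$ and every structure $N$ (in any language) interpreted by $M$ with parameters, the complete theory $\operatorname{Th}(N)$ is G-compact. Statement. Suppose that every complete unstable NIP theory interprets an infinite linear order. Then every theory which is both NIP and SOP is not hereditarily G-compact. -/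

import Mathlib

open FirstOrder

universe u v w u' v' w'

namespace ModelTheoreticNotions

open FirstOrder.Language Cardinal

/-! ### Dividing lines

A theory is a set of sentences of a one-sorted first-order language. The properties below are
witnessed in some nonempty model of the theory; for a complete theory they are the usual notions. -/

section DividingLines

variable {L : FirstOrder.Language.{u, u}}

/-- The formula `φ(x; y)` has the independence property in `M`. -/
def FormulaIP (M : Type w) [L.Structure M] {m n : ℕ} (φ : L.Formula (Fin m ⊕ Fin n)) : Prop :=
  ∃ (a : ℕ → Fin m → M) (b : Set ℕ → Fin n → M),
    ∀ (i : ℕ) (s : Set ℕ), φ.Realize (Sum.elim (a i) (b s)) ↔ i ∈ s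

/-- The formula `φ(x; y)` has the order property in `M`. -/
def FormulaOP (M : Type w) [L.Structure M] {m n : ℕ} (φ : L.Formula (Fin m ⊕ Fin n)) : Prop :=
  ∃ (a : ℕ → Fin m → M) (b : ℕ → Fin n → M),
    ∀ i j : ℕ, φ.Realize (Sum.elim (a i) (b j)) ↔ i < j

/-- The formula `φ(x; y)` has the strict order property in `M`: the sets `φ(M; b i)` form a
strictly increasing sequence. -/
def FormulaSOP (M : Type w) [L.Structure M] {m n : ℕ} (φ : L.Formula (Fin m ⊕ Fin n)) : Prop :=
  ∃ b : ℕ → Fin n → M,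
    ∀ i j : ℕ, i < j →
      {x : Fin m → M | φ.Realize (Sum.elim x (b i))} ⊂
        {x : Fin m → M | φ.Realize (Sum.elim x (b j))}

/-- `T` is NIP: no formula has the independence property in a model of `T`. -/
def IsNIP (T : L.Theory) : Prop :=
  ¬ ∃ (M : Type u) (_ : L.Structure M) (_ : Nonempty M) (m n : ℕ)
      (φ : L.Formula (Fin m ⊕ Fin n)), M ⊨ T ∧ FormulaIP M φ

/-- `T` is unstable: some formula has the order property in a model of `T`. -/
def IsUnstable (T : L.Theory) : Prop :=
  ∃ (M : Type u) (_ : L.Structure M) (_ : Nonempty M) (m n : ℕ)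
      (φ : L.Formula (Fin m ⊕ Fin n)), M ⊨ T ∧ FormulaOP M φ

/-- `T` is SOP: some formula has the strict order property in a model of `T`. -/
def HasSOP (T : L.Theory) : Prop :=
  ∃ (M : Type u) (_ : L.Structure M) (_ : Nonempty M) (m n : ℕ)
      (φ : L.Formula (Fin m ⊕ Fin n)), M ⊨ T ∧ FormulaSOP M φ

end DividingLines

/-! ### Interpretations with parameters -/

section Interpretations

/-- For a map `f : X → N` with `X ⊆ Mⁿ` and a set `P ⊆ Nᵏ`, the preimage of `P` under `f`,
coordinatewise, as a subset of `(Mⁿ)ᵏ = M^(k × n)`. -/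
def pullback {M : Type w} {N : Type w'} {n : ℕ} {X : Set (Fin n → M)} (f : X → N) {k : ℕ}
    (P : Set (Fin k → N)) : Set (Fin k × Fin n → M) :=
  {v | ∃ x : Fin k → X, (∀ i j, v (i, j) = (x i : Fin n → M) j) ∧ (fun i => f (x i)) ∈ P}

/-- The `L`-structure `M` interprets the `L'`-structure `N`, with parameters: there is a surjection
from a definable `X ⊆ Mⁿ` onto `N` such that the preimages of equality, of every basic relation
and of the graph of every basic function of `N` are definable in `M`.
Definability is always with parameters from `M`. -/
def Interprets (L : FirstOrder.Language.{u, v}) (M : Type w) [L.Structure M]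
    (L' : FirstOrder.Language.{u', v'}) (N : Type w') [L'.Structure N] : Prop :=
  ∃ (n : ℕ) (X : Set (Fin n → M)) (f : X → N),
    Function.Surjective f ∧
    (Set.univ : Set M).Definable L X ∧
    (Set.univ : Set M).Definable L (pullback f {y : Fin 2 → N | y 0 = y 1}) ∧
    (∀ (k : ℕ) (R : L'.Relations k),
      (Set.univ : Set M).Definable L (pullback f {y : Fin k → N | Structure.RelMap R y})) ∧
    (∀ (k : ℕ) (F : L'.Functions k),
      (Set.univ : Set M).Definable L
        (pullback f {y : Fin (k + 1) → N | Structure.funMap F (fun i => y i.succ) = y 0}))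

/-- Some model of `T` interprets, with parameters, an infinite linear order. -/
def InterpretsInfiniteLinearOrder {L : FirstOrder.Language.{u, u}} (T : L.Theory) : Prop :=
  ∃ (M : Type u) (_ : L.Structure M) (_ : Nonempty M) (N : Type u) (_ : LinearOrder N),
    M ⊨ T ∧ Infinite N ∧
      letI : FirstOrder.Language.order.Structure N := FirstOrder.Language.orderStructure N
      Interprets L M FirstOrder.Language.order N

end Interpretations

/-! ### Monster models, Lascar distance and G-compactness -/

section GCompactness

variable (L : FirstOrder.Language.{u, u})

/-- The tuples `a` and `b` have the same type over `A` in `M`. -/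
def EqTypeOver {M : Type u} [L.Structure M] (A : Set M) {I : Type u} (a b : I → M) : Prop :=
  ∀ φ : L.Formula (A ⊕ I),
    φ.Realize (Sum.elim (fun c : A => (c : M)) a) ↔ φ.Realize (Sum.elim (fun c : A => (c : M)) b)

/-- `M` is `κ`-saturated: every finitely satisfiable set of formulas in one variable, with
parameters from a set of cardinality less than `κ`, is realized in `M`. -/
def IsSaturated (κ : Cardinal.{u}) (M : Type u) [L.Structure M] : Prop :=
  ∀ A : Set M, #A < κ → ∀ p : Set (L.Formula (A ⊕ Unit)),
    (∀ q : Finset (L.Formula (A ⊕ Unit)), (q : Set (L.Formula (A ⊕ Unit))) ⊆ p →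
      ∃ x : M, ∀ φ ∈ q, φ.Realize (Sum.elim (fun c : A => (c : M)) fun _ => x)) →
    ∃ x : M, ∀ φ ∈ p, φ.Realize (Sum.elim (fun c : A => (c : M)) fun _ => x)

/-- `M` is strongly `κ`-homogeneous: tuples of length less than `κ` with the same type over `∅`
are conjugate under automorphisms of `M`. -/
def IsStronglyHomogeneous (κ : Cardinal.{u}) (M : Type u) [L.Structure M] : Prop :=
  ∀ (I : Type u), #I < κ → ∀ a b : I → M, EqTypeOver L ∅ a b →
    ∃ σ : M ≃[L] M, ∀ i, σ (a i) = b i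

/-- `M` is a monster model (of its complete theory), where "small" means of cardinality less
than `κ`. Every complete theory has such a model, for arbitrarily large `κ`. -/
structure IsMonster (κ : Cardinal.{u}) (M : Type u) [L.Structure M] : Prop where
  aleph0_lt : ℵ₀ < κ
  card_lt : L.card < κ
  saturated : IsSaturated L κ M
  homogeneous : IsStronglyHomogeneous L κ M

/-- The Lascar distance of `a` and `b` is at most `n`: there are `a = c 0, …, c n = b` such that
any two consecutive tuples have the same type over some elementary substructure. -/
def LascarDistLE {M : Type u} [L.Structure M] {I : Type u} (n : ℕ) (a b : I → M) : Prop :=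
  ∃ c : ℕ → I → M, c 0 = a ∧ c n = b ∧
    ∀ i < n, ∃ S : L.ElementarySubstructure M, EqTypeOver L (S : Set M) (c i) (c (i + 1))

/-- `a` and `b` have the same Lascar strong type (finite Lascar distance). -/
def LascarEquiv {M : Type u} [L.Structure M] {I : Type u} (a b : I → M) : Prop :=
  ∃ n : ℕ, LascarDistLE L n a b

variable {L}

/-- A complete theory `T` is G-compact if in its monster model, the Lascar strong type of every
small tuple (possibly infinite) has finite diameter. This does not depend on the monster model. -/
def IsGCompact (T : L.Theory) : Prop :=
  ∃ (κ : Cardinal.{u}) (M : Type u) (_ : L.Structure M) (_ : Nonempty M),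
    M ⊨ T ∧ IsMonster L κ M ∧
      ∀ I : Type u, #I < κ → ∀ a : I → M,
        ∃ n : ℕ, ∀ b : I → M, LascarEquiv L a b → LascarDistLE L n a b

/-- `T` is hereditarily G-compact: for every model `M` of `T` and every structure `N`, in any
language, which is interpreted in `M` with parameters, the complete theory of `N` is G-compact. -/
def IsHereditarilyGCompact (T : L.Theory) : Prop :=
  ∀ (M : Type u) [L.Structure M] [Nonempty M], M ⊨ T →
    ∀ (L' : FirstOrder.Language.{u, u}) (N : Type u) [L'.Structure N] [Nonempty N],
      Interprets L M L' N → IsGCompact (L'.completeTheory N)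

end GCompactness

end ModelTheoreticNotions

open ModelTheoreticNotions

/-! A strictly increasing family of definable sets gives the order property, so the complete theory
of a model of `T` with SOP is unstable. It is also NIP, as its models are models of `T`. The
conjecture then yields an infinite linear order `K` interpreted in a model of `T`. It remains to
interpret, in some model of `T`, a structure whose theory is not G-compact
(`not_isHereditarilyGCompact`).

The classical source of unbounded Lascar diameters is a disjoint union of circles, the `n`-th made
of `n + 1` consecutive copies of an order, where only the arcs from a point to just before its next
copy are visible. Over a dense order this is easy, but `K` is arbitrary. Ramsey's theorem provides,
for every rank, points `a < b < c` of `K` such that `[a, b)`, `[b, c)` and `[a, c)` have the same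
Ehrenfeucht–Fraïssé type of this rank. In an ultrapower this holds for all ranks at once
(`exists_germ_efType_Ico_eq`), so `J = [a, b)` is elementarily equivalent to `J + J`. It follows
that `J` is equivalent to the lexicographic product of `J` with any discrete order with endpoints
(`efType_block`). Types of tuples in such products depend only on the second coordinates and on the
order and adjacency of the first ones (`sim_lex`).

The circles over `J` are thus equivalent to those over `Base ×ₗ J`, where `Base` is `ω + ζ + ζ +
ω*`. Joined cyclically, copies of `Base` form a cycle of copies of `ζ`, and moving by one `ζ` is an
automorphism. The two inner copies of `ζ` cannot be distinguished over the elementary submodel above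
`ω + ω*`. Hence each such rotation is a step of Lascar distance one, and three of them advance the
label by one (`lascarDistLE_tuple`). In particular, all these distances are finite.

Conversely, every elementary submodel contains points whose `n + 1` arcs cover the `n`-th circle, so
one Lascar step moves a point only within a common arc (`linked_of_lascarDistLE`) and changes its
label by at most one. In the circle with `2 d + 2` labels, opposite points are therefore more than
`d` steps apart (`not_linked`). A tuple with one point in every circle has a Lascar strong type of
infinite diameter (`not_isGCompact`). -/

namespace EhrenfeuchtFraisse

/-! ### Ehrenfeucht–Fraïssé types of subsets of linear orders. -/

open Set Filter

/-- The codes of Ehrenfeucht–Fraïssé types of rank `m` of linear orders. -/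
def EFType : ℕ → Type
  | 0 => Unit
  | m + 1 => Set (EFType m × EFType m)

instance EFType.finite : ∀ m, Finite (EFType m)
  | 0 => inferInstanceAs (Finite Unit)
  | m + 1 => by
    have := EFType.finite m
    exact inferInstanceAs (Finite (Set (EFType m × EFType m)))

/-- The Ehrenfeucht–Fraïssé type of rank `m` of a subset of a linear order: it records the types
of rank `m - 1` of the two parts into which a point cuts the set. -/
def efType {α : Type*} [LinearOrder α] : (m : ℕ) → Set α → EFType m
  | 0, _ => ()
  | m + 1, s => {p | ∃ x ∈ s, p = (efType m (s ∩ Iio x), efType m (s ∩ Ioi x))}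

variable {α β : Type*} [LinearOrder α] [LinearOrder β]

/-- This is one round of the back-and-forth game. After a move the game splits into independent
games on the two sides of the chosen point. -/
theorem efType_succ_eq_iff {m : ℕ} {s : Set α} {t : Set β} :
    efType (m + 1) s = efType (m + 1) t ↔
      (∀ x ∈ s, ∃ y ∈ t, efType m (s ∩ Iio x) = efType m (t ∩ Iio y) ∧
        efType m (s ∩ Ioi x) = efType m (t ∩ Ioi y)) ∧
      (∀ y ∈ t, ∃ x ∈ s, efType m (s ∩ Iio x) = efType m (t ∩ Iio y) ∧
        efType m (s ∩ Ioi x) = efType m (t ∩ Ioi y)) := by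
  constructor
  · intro h
    refine ⟨fun x hx => ?_, fun y hy => ?_⟩
    · have : (efType m (s ∩ Iio x), efType m (s ∩ Ioi x)) ∈
          (show Set (EFType m × EFType m) from efType (m + 1) t) := by
        rw [← h]; exact ⟨x, hx, rfl⟩
      obtain ⟨y, hy, hxy⟩ := this
      exact ⟨y, hy, (Prod.ext_iff.1 hxy).1, (Prod.ext_iff.1 hxy).2⟩
    · have : (efType m (t ∩ Iio y), efType m (t ∩ Ioi y)) ∈
          (show Set (EFType m × EFType m) from efType (m + 1) s) := by
        rw [h]; exact ⟨y, hy, rfl⟩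
      obtain ⟨x, hx, hxy⟩ := this
      exact ⟨x, hx, (Prod.ext_iff.1 hxy).1.symm, (Prod.ext_iff.1 hxy).2.symm⟩
  · rintro ⟨h₁, h₂⟩
    refine Set.ext fun p => ⟨?_, ?_⟩
    · rintro ⟨x, hx, rfl⟩
      obtain ⟨y, hy, e₁, e₂⟩ := h₁ x hx
      exact ⟨y, hy, by rw [e₁, e₂]⟩
    · rintro ⟨y, hy, rfl⟩
      obtain ⟨x, hx, e₁, e₂⟩ := h₂ y hy
      exact ⟨x, hx, by rw [e₁, e₂]⟩

theorem efType_eq_of_succ {m : ℕ} : ∀ {s : Set α} {t : Set β},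
    efType (m + 1) s = efType (m + 1) t → efType m s = efType m t := by
  induction m with
  | zero => intros; rfl
  | succ m ih =>
    intro s t h
    rw [efType_succ_eq_iff] at h ⊢
    exact ⟨fun x hx => (h.1 x hx).imp fun y hy => ⟨hy.1, ih hy.2.1, ih hy.2.2⟩,
      fun x hx => (h.2 x hx).imp fun y hy => ⟨hy.1, ih hy.2.1, ih hy.2.2⟩⟩

theorem efType_image {m : ℕ} {f : α → β} (hf : StrictMono f) :
    ∀ s : Set α, efType m (f '' s) = efType m s := by
  induction m with
  | zero => intros; rfl
  | succ m ih =>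
    intro s
    have h₁ (x : α) : f '' s ∩ Iio (f x) = f '' (s ∩ Iio x) := by
      ext y; constructor
      · rintro ⟨⟨z, hz, rfl⟩, h⟩
        exact ⟨z, ⟨hz, hf.lt_iff_lt.1 h⟩, rfl⟩
      · rintro ⟨z, ⟨hz, h⟩, rfl⟩
        exact ⟨⟨z, hz, rfl⟩, hf h⟩
    have h₂ (x : α) : f '' s ∩ Ioi (f x) = f '' (s ∩ Ioi x) := by
      ext y; constructor
      · rintro ⟨⟨z, hz, rfl⟩, h⟩
        exact ⟨z, ⟨hz, hf.lt_iff_lt.1 h⟩, rfl⟩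
      · rintro ⟨z, ⟨hz, h⟩, rfl⟩
        exact ⟨⟨z, hz, rfl⟩, hf h⟩
    rw [efType_succ_eq_iff]
    refine ⟨?_, fun x hx => ⟨f x, ⟨x, hx, rfl⟩, ?_⟩⟩
    · rintro _ ⟨x, hx, rfl⟩
      exact ⟨x, hx, by rw [h₁, ih], by rw [h₂, ih]⟩
    · rw [h₁, h₂, ih, ih]; exact ⟨rfl, rfl⟩

theorem union_cut_left {s t : Set α} (hst : ∀ x ∈ s, ∀ y ∈ t, x < y) {x : α} (hx : x ∈ s) :
    (s ∪ t) ∩ Iio x = s ∩ Iio x ∧ (s ∪ t) ∩ Ioi x = (s ∩ Ioi x) ∪ t := by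
  constructor
  · ext y
    simp only [mem_inter_iff, mem_union, mem_Iio]
    exact ⟨fun h => ⟨h.1.resolve_right fun hy => (hst x hx y hy).asymm h.2, h.2⟩,
      fun h => ⟨Or.inl h.1, h.2⟩⟩
  · ext y
    simp only [mem_inter_iff, mem_union, mem_Ioi]
    exact ⟨fun h => h.1.imp (fun h' => ⟨h', h.2⟩) id,
      fun h => h.elim (fun h => ⟨Or.inl h.1, h.2⟩) fun h => ⟨Or.inr h, hst x hx y h⟩⟩

theorem union_cut_right {s t : Set α} (hst : ∀ x ∈ s, ∀ y ∈ t, x < y) {x : α} (hx : x ∈ t) :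
    (s ∪ t) ∩ Iio x = s ∪ (t ∩ Iio x) ∧ (s ∪ t) ∩ Ioi x = t ∩ Ioi x := by
  constructor
  · ext y
    simp only [mem_inter_iff, mem_union, mem_Iio]
    exact ⟨fun h => h.1.imp id fun h' => ⟨h', h.2⟩,
      fun h => h.elim (fun h => ⟨Or.inl h, hst y h x hx⟩) fun h => ⟨Or.inr h.1, h.2⟩⟩
  · ext y
    simp only [mem_inter_iff, mem_union, mem_Ioi]
    exact ⟨fun h => ⟨h.1.resolve_left fun hy => (hst y hy x hx).asymm h.2, h.2⟩,
      fun h => ⟨Or.inr h.1, h.2⟩⟩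

/-- The Ehrenfeucht–Fraïssé type of an ordered sum is determined by those of the summands. -/
theorem efType_union {m : ℕ} : ∀ {s t : Set α} {s' t' : Set β},
    (∀ x ∈ s, ∀ y ∈ t, x < y) → (∀ x ∈ s', ∀ y ∈ t', x < y) →
    efType m s = efType m s' → efType m t = efType m t' →
    efType m (s ∪ t) = efType m (s' ∪ t') := by
  induction m with
  | zero => intros; rfl
  | succ m ih =>
    intro s t s' t' hst hst' hs ht
    -- A move in one summand lowers the rank there and leaves the other summand whole, so the latter
    -- is needed at the lower rank too.
    have hs' := efType_eq_of_succ hs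
    have ht' := efType_eq_of_succ ht
    rw [efType_succ_eq_iff] at hs ht ⊢
    constructor
    · rintro x (hx | hx)
      · obtain ⟨y, hy, e₁, e₂⟩ := hs.1 x hx
        refine ⟨y, Or.inl hy, ?_⟩
        rw [(union_cut_left hst hx).1, (union_cut_left hst hx).2, (union_cut_left hst' hy).1,
          (union_cut_left hst' hy).2]
        exact ⟨e₁, ih (fun a ha => hst a ha.1) (fun a ha => hst' a ha.1) e₂ ht'⟩
      · obtain ⟨y, hy, e₁, e₂⟩ := ht.1 x hx
        refine ⟨y, Or.inr hy, ?_⟩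
        rw [(union_cut_right hst hx).1, (union_cut_right hst hx).2, (union_cut_right hst' hy).1,
          (union_cut_right hst' hy).2]
        exact ⟨ih (fun a ha b hb => hst a ha b hb.1) (fun a ha b hb => hst' a ha b hb.1) hs' e₁, e₂⟩
    · rintro y (hy | hy)
      · obtain ⟨x, hx, e₁, e₂⟩ := hs.2 y hy
        refine ⟨x, Or.inl hx, ?_⟩
        rw [(union_cut_left hst hx).1, (union_cut_left hst hx).2, (union_cut_left hst' hy).1,
          (union_cut_left hst' hy).2]
        exact ⟨e₁, ih (fun a ha => hst a ha.1) (fun a ha => hst' a ha.1) e₂ ht'⟩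
      · obtain ⟨x, hx, e₁, e₂⟩ := ht.2 y hy
        refine ⟨x, Or.inr hx, ?_⟩
        rw [(union_cut_right hst hx).1, (union_cut_right hst hx).2, (union_cut_right hst' hy).1,
          (union_cut_right hst' hy).2]
        exact ⟨ih (fun a ha b hb => hst a ha b hb.1) (fun a ha b hb => hst' a ha b hb.1) hs' e₁, e₂⟩

theorem efType_empty (m : ℕ) : efType m (∅ : Set α) = efType m (∅ : Set β) := by
  cases m with
  | zero => rfl
  | succ m => rw [efType_succ_eq_iff]; exact ⟨fun x hx => hx.elim, fun x hx => hx.elim⟩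

theorem efType_singleton (m : ℕ) (x : α) (y : β) :
    efType m ({x} : Set α) = efType m ({y} : Set β) := by
  cases m with
  | zero => rfl
  | succ m =>
    have h₁ : ({x} : Set α) ∩ Iio x = ∅ ∧ ({x} : Set α) ∩ Ioi x = ∅ := by
      constructor <;> ext w <;> simp +contextual
    have h₂ : ({y} : Set β) ∩ Iio y = ∅ ∧ ({y} : Set β) ∩ Ioi y = ∅ := by
      constructor <;> ext w <;> simp +contextual
    rw [efType_succ_eq_iff]
    simp only [mem_singleton_iff, exists_eq_left, forall_eq, h₁, h₂, and_self]
    exact efType_empty m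

/-! ### Ultraproducts -/

section Ultraproduct

variable {K ι : Type*} (U : Ultrafilter ι)

/-- The internal subset of the ultrapower of `K` given by a family of subsets. -/
def internalSet (s : ι → Set K) : Set ((U : Filter ι).Germ K) :=
  {g | ∃ x : ι → K, (x : (U : Filter ι).Germ K) = g ∧ ∀ᶠ i in U, x i ∈ s i}

variable {U}

theorem coe_mem_internalSet {s : ι → Set K} {x : ι → K} :
    (x : (U : Filter ι).Germ K) ∈ internalSet U s ↔ ∀ᶠ i in U, x i ∈ s i := by
  constructor
  · rintro ⟨y, hxy, hy⟩
    filter_upwards [hy, Germ.coe_eq.1 hxy] with i h₁ h₂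
    exact h₂ ▸ h₁
  · exact fun h => ⟨x, rfl, h⟩

theorem internalSet_inter_Iio (s : ι → Set α) (x : ι → α) :
    internalSet U s ∩ Iio (x : (U : Filter ι).Germ α) = internalSet U fun i => s i ∩ Iio (x i) := by
  ext g
  induction g using Germ.inductionOn with
  | _ y => simp only [mem_inter_iff, coe_mem_internalSet, mem_Iio, Germ.coe_lt, eventually_and]

theorem internalSet_inter_Ioi (s : ι → Set α) (x : ι → α) :
    internalSet U s ∩ Ioi (x : (U : Filter ι).Germ α) = internalSet U fun i => s i ∩ Ioi (x i) := by
  ext g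
  induction g using Germ.inductionOn with
  | _ y => simp only [mem_inter_iff, coe_mem_internalSet, mem_Ioi, Germ.coe_lt, eventually_and]

/-- The type of an internal set is the limit of the types of its components. -/
theorem efType_internalSet_eq_iff {m : ℕ} : ∀ (s : ι → Set α) (t : EFType m),
    efType m (internalSet U s) = t ↔ ∀ᶠ i in U, efType m (s i) = t := by
  induction m with
  | zero => intro s t; exact iff_of_true rfl (Eventually.of_forall fun _ => rfl)
  | succ m ih =>
    intro s t
    -- This is Łoś's theorem for one element of the code. Points of an internal set are germs of
    -- points of its components, and both sides of a cut are internal again.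
    have key (p : EFType m × EFType m) :
        p ∈ (show Set (EFType m × EFType m) from efType (m + 1) (internalSet U s)) ↔
          ∀ᶠ i in U, p ∈ (show Set (EFType m × EFType m) from efType (m + 1) (s i)) := by
      constructor
      · rintro ⟨g, hg, hp⟩
        induction g using Germ.inductionOn with
        | _ x =>
          rw [internalSet_inter_Iio, internalSet_inter_Ioi, Prod.ext_iff, eq_comm, ih, eq_comm,
            ih] at hp
          filter_upwards [coe_mem_internalSet.1 hg, hp.1, hp.2] with i h₁ h₂ h₃
          exact ⟨x i, h₁, Prod.ext h₂.symm h₃.symm⟩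
      · intro h
        obtain ⟨i₀, x₀, -⟩ := h.exists
        have : Nonempty α := ⟨x₀⟩
        choose! x hx using fun i (hi : p ∈ (show Set (EFType m × EFType m) from
          efType (m + 1) (s i))) => hi
        refine ⟨(x : (U : Filter ι).Germ α), coe_mem_internalSet.2 (h.mono fun i hi => (hx i hi).1),
          ?_⟩
        rw [internalSet_inter_Iio, internalSet_inter_Ioi, Prod.ext_iff, eq_comm, ih, eq_comm, ih]
        exact ⟨h.mono fun i hi => (congrArg Prod.fst (hx i hi).2).symm,
          h.mono fun i hi => (congrArg Prod.snd (hx i hi).2).symm⟩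
    have ext_iff' (A B : EFType (m + 1)) : A = B ↔
        ∀ p, p ∈ (show Set (EFType m × EFType m) from A) ↔
          p ∈ (show Set (EFType m × EFType m) from B) := Set.ext_iff
    -- There are finitely many pairs `p`, so the quantifier over `p` passes through the ultrafilter.
    simp only [ext_iff', eventually_all, key]
    refine forall_congr' fun p => ?_
    by_cases hp : p ∈ (show Set (EFType m × EFType m) from t)
    · simp only [hp, iff_true]
    · simp only [hp, iff_false]
      exact Ultrafilter.eventually_not.symm

end Ultraproduct

/-! ### Intervals with the same type as their double. -/

/-- Every infinite linear order has intervals `[a, b)` and `[b, c)` such that these and their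
union have the same types up to a given rank. -/
theorem exists_efType_Ico_eq [Infinite α] (n : ℕ) :
    ∃ a b c : α, a < b ∧ b < c ∧ ∀ m ≤ n, efType m (Ico a b) = efType m (Ico a c) ∧
      efType m (Ico b c) = efType m (Ico a c) := by
  classical
  -- Ramsey's theorem for a triangle, proved with a nonprincipal ultrafilter. A pair is coloured by
  -- the type of the interval that it spans and by its order.
  let V : Ultrafilter α := hyperfilter α
  let col (m : ℕ) (x y : α) : EFType m × Prop := (efType m (Ico (min x y) (max x y)), x < y)
  have lim (T : Type) [Finite T] (f : α → T) : ∃ t, ∀ᶠ y in (V : Filter α), f y = t := by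
    have : ∀ᶠ y in (V : Filter α), ∃ t, f y = t := Eventually.of_forall fun y => ⟨_, rfl⟩
    exact Ultrafilter.eventually_exists_iff.1 this
  -- `l₁ m x` is the colour of `(x, y)` for almost all `y`, and `l₂ m` is the value of `l₁ m x` for
  -- almost all `x`. Choosing `x`, `y`, `z` generic in turn gives all three pairs the colour `l₂ m`.
  choose l₁ hl₁ using fun m x => lim (EFType m × Prop) (col m x)
  choose l₂ hl₂ using fun m => lim (EFType m × Prop) (l₁ m)
  have ne (x : α) : ∀ᶠ y in (V : Filter α), y ≠ x :=
    (Set.finite_singleton x).compl_mem_hyperfilter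
  have all (f : ℕ → α → Prop) (hf : ∀ m, ∀ᶠ y in (V : Filter α), f m y) :
      ∀ᶠ y in (V : Filter α), ∀ m ≤ n, f m y :=
    (eventually_all_finite (Set.finite_Iic n)).2 fun m _ => hf m
  obtain ⟨x, hx⟩ := (all _ hl₂).exists
  obtain ⟨y, hxy, hy, hyx⟩ := ((all _ fun m => hl₁ m x).and ((all _ hl₂).and (ne x))).exists
  obtain ⟨z, hxz, hyz, hzx, hzy⟩ :=
    ((all _ fun m => hl₁ m x).and ((all _ fun m => hl₁ m y).and ((ne x).and (ne y)))).exists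
  have e₁ (m) (hm : m ≤ n) : col m x y = col m x z := (hxy m hm).trans (hxz m hm).symm
  have e₂ (m) (hm : m ≤ n) : col m x y = col m y z := by
    rw [hxy m hm, hx m hm, hyz m hm, hy m hm]
  have o₁ : x < y ↔ x < z := iff_of_eq (congrArg Prod.snd (e₁ 0 n.zero_le))
  have o₂ : x < y ↔ y < z := iff_of_eq (congrArg Prod.snd (e₂ 0 n.zero_le))
  have f₁ (m) (hm : m ≤ n) := congrArg Prod.fst (e₁ m hm)
  have f₂ (m) (hm : m ≤ n) := congrArg Prod.fst (e₂ m hm)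
  simp only [col] at f₁ f₂
  rcases lt_or_ge x y with h | h
  · have hxz' := o₁.1 h
    have hyz' := o₂.1 h
    simp only [min_eq_left h.le, max_eq_right h.le, min_eq_left hxz'.le, max_eq_right hxz'.le,
      min_eq_left hyz'.le, max_eq_right hyz'.le] at f₁ f₂
    exact ⟨x, y, z, h, hyz', fun m hm => ⟨f₁ m hm, (f₂ m hm).symm.trans (f₁ m hm)⟩⟩
  -- The monochromatic triple is decreasing here, so it is read backwards.
  · have hxz' : z < x := (not_lt.1 (mt o₁.2 h.not_gt)).lt_of_ne hzx
    have hyz' : z < y := (not_lt.1 (mt o₂.2 h.not_gt)).lt_of_ne hzy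
    simp only [min_eq_right h, max_eq_left h, min_eq_right hxz'.le, max_eq_left hxz'.le,
      min_eq_right hyz'.le, max_eq_left hyz'.le] at f₁ f₂
    exact ⟨z, y, x, hyz', h.lt_of_ne hyx, fun m hm =>
      ⟨(f₂ m hm).symm.trans (f₁ m hm), f₁ m hm⟩⟩

/-- Every infinite linear order has an elementary extension with intervals `[a, b)` and `[b, c)`
such that these and their union have the same types of all ranks. -/
theorem exists_germ_efType_Ico_eq [Infinite α] :
    ∃ a b c : (hyperfilter ℕ : Filter ℕ).Germ α, a < b ∧ b < c ∧
      ∀ m, efType m (Ico a b) = efType m (Ico a c) ∧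
      efType m (Ico b c) = efType m (Ico a c) := by
  choose a b c hab hbc h using fun n => exists_efType_Ico_eq (α := α) n
  have Ico_eq (x y : ℕ → α) : Ico (x : (hyperfilter ℕ : Filter ℕ).Germ α) y =
      internalSet (hyperfilter ℕ) fun i => Ico (x i) (y i) := by
    ext g
    induction g using Germ.inductionOn with
    | _ z => simp only [coe_mem_internalSet, mem_Ico, Germ.coe_lt, Germ.coe_le, eventually_and, EventuallyLE]
  refine ⟨a, b, c, Germ.coe_lt.2 (Eventually.of_forall hab),
    Germ.coe_lt.2 (Eventually.of_forall hbc), fun m => ?_⟩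
  -- The `n`-th triple is good for ranks up to `n`, hence almost all triples are good for a given
  -- rank.
  have large : ∀ᶠ n in (hyperfilter ℕ : Filter ℕ), m ≤ n :=
    Nat.hyperfilter_le_atTop (eventually_ge_atTop m)
  rw [Ico_eq, Ico_eq, Ico_eq]
  have hac := (efType_internalSet_eq_iff (U := hyperfilter ℕ) (fun i => Ico (a i) (c i)) _).1
    (rfl : efType m _ = _)
  constructor
  · rw [efType_internalSet_eq_iff]
    filter_upwards [large, hac] with i h₁ h₂
    rw [(h i m h₁).1, h₂]
  · rw [efType_internalSet_eq_iff]
    filter_upwards [large, hac] with i h₁ h₂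
    rw [(h i m h₁).2, h₂]

end EhrenfeuchtFraisse

namespace EhrenfeuchtFraisse

open Set

/-! ### Lexicographic products with an idempotent order -/

section Lex

/-- The order `J` has the same types as `J + J`. -/
def IsIdempotentOrder (J : Type u) [LinearOrder J] : Prop :=
  ∀ (m : ℕ) (γ : Type u) [LinearOrder γ] (s t : Set γ), (∀ x ∈ s, ∀ y ∈ t, x < y) →
    efType m s = efType m (univ : Set J) → efType m t = efType m (univ : Set J) →
    efType m (s ∪ t) = efType m (univ : Set J)

variable {I : Type*} {J : Type*}

/-- The part of the lexicographic product `I × J` lying over `A ⊆ I`. -/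
def block (J : Type*) (A : Set I) : Set (I ×ₗ J) := {p | (ofLex p).1 ∈ A}

/-- The copy of `s ⊆ J` over the point `i` of the lexicographic product `I × J`. -/
def fiber (i : I) (s : Set J) : Set (I ×ₗ J) := (fun y => toLex (i, y)) '' s

theorem mem_block {A : Set I} {i : I} {y : J} : toLex (i, y) ∈ block J A ↔ i ∈ A := Iff.rfl

theorem mem_fiber {i j : I} {y : J} {s : Set J} : toLex (j, y) ∈ fiber i s ↔ j = i ∧ y ∈ s := by
  constructor
  · rintro ⟨z, hz, h⟩
    have := toLex.injective h
    simp only [Prod.mk.injEq] at this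
    exact ⟨this.1.symm, this.2 ▸ hz⟩
  · rintro ⟨rfl, h⟩
    exact ⟨y, h, rfl⟩

theorem block_empty : block J (∅ : Set I) = ∅ := rfl

theorem block_singleton (i : I) : block J {i} = fiber i univ := by
  ext p; obtain ⟨⟨j, y⟩, rfl⟩ := toLex.surjective p
  simp [mem_block, mem_fiber]

theorem fiber_subset_block {i : I} {s : Set J} : fiber i s ⊆ block J {i} := by
  rintro _ ⟨y, -, rfl⟩; rfl

variable [LinearOrder I] [LinearOrder J]

theorem efType_fiber (m : ℕ) (i : I) (s : Set J) : efType m (fiber i s) = efType m s :=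
  efType_image (f := fun y => toLex (i, y))
    (fun a b h => (Prod.Lex.toLex_lt_toLex (x := (i, a)) (y := (i, b))).2 (Or.inr ⟨rfl, h⟩)) s

theorem block_inter_Iio (A : Set I) {i : I} (hi : i ∈ A) (y : J) :
    block J A ∩ Iio (toLex (i, y)) = block J (A ∩ Iio i) ∪ fiber i (Iio y) := by
  ext p; obtain ⟨⟨j, z⟩, rfl⟩ := toLex.surjective p
  simp only [mem_inter_iff, mem_union, mem_block, mem_fiber, mem_Iio, Prod.Lex.toLex_lt_toLex]
  constructor
  · rintro ⟨h, h' | h'⟩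
    · exact Or.inl ⟨h, h'⟩
    · exact Or.inr h'
  · rintro (h | h)
    · exact ⟨h.1, Or.inl h.2⟩
    · exact ⟨h.1 ▸ hi, Or.inr h⟩

theorem block_inter_Ioi (A : Set I) {i : I} (hi : i ∈ A) (y : J) :
    block J A ∩ Ioi (toLex (i, y)) = fiber i (Ioi y) ∪ block J (A ∩ Ioi i) := by
  ext p; obtain ⟨⟨j, z⟩, rfl⟩ := toLex.surjective p
  simp only [mem_inter_iff, mem_union, mem_block, mem_fiber, mem_Ioi, Prod.Lex.toLex_lt_toLex]
  constructor
  · rintro ⟨h, h' | h'⟩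
    · exact Or.inr ⟨h, h'⟩
    · exact Or.inl ⟨h'.1.symm, h'.2⟩
  · rintro (h | h)
    · exact ⟨h.1 ▸ hi, Or.inr ⟨h.1.symm, h.2⟩⟩
    · exact ⟨h.1, Or.inl h.2⟩

theorem block_lt_block {A B : Set I} (h : ∀ i ∈ A, ∀ j ∈ B, i < j) :
    ∀ p ∈ block J A, ∀ q ∈ block J B, p < q := fun _ hp _ hq =>
  Prod.Lex.lt_iff.2 (Or.inl (h _ hp _ hq))

/-- Nonempty discrete with two endpoints. -/
structure IsDiscreteWithEndpoints (A : Set I) : Prop where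
  least : ∃ i, IsLeast A i
  greatest : ∃ i, IsGreatest A i
  succ : ∀ i ∈ A, (A ∩ Ioi i).Nonempty → ∃ j, IsLeast (A ∩ Ioi i) j
  pred : ∀ i ∈ A, (A ∩ Iio i).Nonempty → ∃ j, IsGreatest (A ∩ Iio i) j

/-- The predecessor of `i` becomes the new greatest element. Being closed under nonempty cuts is
what makes this class of orders fit for induction on the rank. -/
theorem IsDiscreteWithEndpoints.inter_Iio {A : Set I} (h : IsDiscreteWithEndpoints A) {i : I}
    (hi : i ∈ A) (hne : (A ∩ Iio i).Nonempty) : IsDiscreteWithEndpoints (A ∩ Iio i) where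
  least := by
    obtain ⟨a, ha⟩ := h.least
    obtain ⟨b, hb⟩ := hne
    exact ⟨a, ⟨ha.1, (ha.2 hb.1).trans_lt hb.2⟩, fun c hc => ha.2 hc.1⟩
  greatest := h.pred i hi hne
  succ := by
    rintro j hj ⟨k, hk⟩
    obtain ⟨l, hl⟩ := h.succ j hj.1 ⟨k, hk.1.1, hk.2⟩
    exact ⟨l, ⟨⟨hl.1.1, (hl.2 ⟨hk.1.1, hk.2⟩).trans_lt hk.1.2⟩, hl.1.2⟩,
      fun c hc => hl.2 ⟨hc.1.1, hc.2⟩⟩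
  pred := by
    rintro j hj ⟨k, hk⟩
    obtain ⟨l, hl⟩ := h.pred j hj.1 ⟨k, hk.1.1, hk.2⟩
    exact ⟨l, ⟨⟨hl.1.1, lt_trans hl.1.2 hj.2⟩, hl.1.2⟩, fun c hc => hl.2 ⟨hc.1.1, hc.2⟩⟩

theorem IsDiscreteWithEndpoints.inter_Ioi {A : Set I} (h : IsDiscreteWithEndpoints A) {i : I}
    (hi : i ∈ A) (hne : (A ∩ Ioi i).Nonempty) : IsDiscreteWithEndpoints (A ∩ Ioi i) where
  greatest := by
    obtain ⟨a, ha⟩ := h.greatest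
    obtain ⟨b, hb⟩ := hne
    exact ⟨a, ⟨ha.1, lt_of_lt_of_le hb.2 (ha.2 hb.1)⟩, fun c hc => ha.2 hc.1⟩
  least := h.succ i hi hne
  pred := by
    rintro j hj ⟨k, hk⟩
    obtain ⟨l, hl⟩ := h.pred j hj.1 ⟨k, hk.1.1, hk.2⟩
    exact ⟨l, ⟨⟨hl.1.1, lt_of_lt_of_le hk.1.2 (hl.2 ⟨hk.1.1, hk.2⟩)⟩, hl.1.2⟩,
      fun c hc => hl.2 ⟨hc.1.1, hc.2⟩⟩
  succ := by
    rintro j hj ⟨k, hk⟩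
    obtain ⟨l, hl⟩ := h.succ j hj.1 ⟨k, hk.1.1, hk.2⟩
    exact ⟨l, ⟨⟨hl.1.1, lt_trans hj.2 hl.1.2⟩, hl.1.2⟩, fun c hc => hl.2 ⟨hc.1.1, hc.2⟩⟩

theorem isDiscreteWithEndpoints_Icc (k : ℕ) : IsDiscreteWithEndpoints (Icc (0 : ℤ) k) where
  least := ⟨0, ⟨le_rfl, by positivity⟩, fun _ h => h.1⟩
  greatest := ⟨k, ⟨by positivity, le_rfl⟩, fun _ h => h.2⟩
  succ := by
    rintro i hi ⟨j, hj⟩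
    simp only [mem_inter_iff, mem_Icc, mem_Ioi] at *
    refine ⟨i + 1, by simp only [mem_inter_iff, mem_Icc, mem_Ioi]; lia, fun c hc => ?_⟩
    simp only [mem_inter_iff, mem_Icc, mem_Ioi] at hc; lia
  pred := by
    rintro i hi ⟨j, hj⟩
    simp only [mem_inter_iff, mem_Icc, mem_Iio] at *
    refine ⟨i - 1, by simp only [mem_inter_iff, mem_Icc, mem_Iio]; lia, fun c hc => ?_⟩
    simp only [mem_inter_iff, mem_Icc, mem_Iio] at hc; lia

end Lex

section Idempotent

variable {J : Type u} [LinearOrder J]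

/-- The `k + 1` consecutive copies of `J` are absorbed one at a time. -/
theorem efType_block_Icc (hJ : IsIdempotentOrder J) (m k : ℕ) :
    efType m (block J (Icc (0 : ℤ) k)) = efType m (univ : Set J) := by
  have single (i : ℤ) : efType m (block J {i}) = efType m (univ : Set J) := by
    rw [block_singleton, efType_fiber]
  induction k with
  | zero => simpa using single 0
  | succ k ih =>
    have : block J (Icc (0 : ℤ) (k + 1 : ℕ)) = block J (Icc (0 : ℤ) k) ∪ block J {(k + 1 : ℤ)} := by
      ext p
      simp only [block, mem_union, mem_ofPred_eq, mem_Icc, mem_singleton_iff]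
      lia
    rw [this]
    refine hJ m (ℤ ×ₗ J) _ _ (block_lt_block (A := Icc (0 : ℤ) k) (B := {(k + 1 : ℤ)}) fun i hi j hj => ?_)
      ih (single _)
    simp only [mem_Icc, mem_singleton_iff] at hi hj
    lia

/-- Cutting lexicographic products over discrete orders with endpoints at similar places gives the
same types. -/
theorem efType_cut_eq {m : ℕ} {I I' : Type*} [LinearOrder I] [LinearOrder I'] {A : Set I}
    {B : Set I'} (hA : IsDiscreteWithEndpoints A) (hB : IsDiscreteWithEndpoints B)
    (ihA : ∀ A : Set I, IsDiscreteWithEndpoints A → efType m (block J A) = efType m (univ : Set J))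
    (ihB : ∀ A : Set I', IsDiscreteWithEndpoints A →
      efType m (block J A) = efType m (univ : Set J))
    {i : I} {j : I'} (hi : i ∈ A) (hj : j ∈ B)
    (h₁ : (A ∩ Iio i).Nonempty ↔ (B ∩ Iio j).Nonempty)
    (h₂ : (A ∩ Ioi i).Nonempty ↔ (B ∩ Ioi j).Nonempty) (y : J) :
    efType m (block J A ∩ Iio (toLex (i, y))) = efType m (block J B ∩ Iio (toLex (j, y))) ∧
      efType m (block J A ∩ Ioi (toLex (i, y))) = efType m (block J B ∩ Ioi (toLex (j, y))) := by
  rw [block_inter_Iio A hi, block_inter_Iio B hj, block_inter_Ioi A hi, block_inter_Ioi B hj]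
  constructor
  · refine efType_union ?_ ?_ ?_ (by rw [efType_fiber, efType_fiber])
    · intro p hp q hq
      refine block_lt_block (A := A ∩ Iio i) (B := {i}) ?_ p hp q (fiber_subset_block hq)
      rintro a ha b rfl; exact ha.2
    · intro p hp q hq
      refine block_lt_block (A := B ∩ Iio j) (B := {j}) ?_ p hp q (fiber_subset_block hq)
      rintro a ha b rfl; exact ha.2
    -- A nonempty part is discrete with endpoints, so its block has the type of `J` whatever its
    -- size. Only emptiness matters.
    · rcases (A ∩ Iio i).eq_empty_or_nonempty with h | h
      · rw [h, not_nonempty_iff_eq_empty.1 (mt h₁.2 (not_nonempty_iff_eq_empty.2 h)), block_empty,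
          block_empty]
        exact efType_empty m
      · rw [ihA _ (hA.inter_Iio hi h), ihB _ (hB.inter_Iio hj (h₁.1 h))]
  · refine efType_union ?_ ?_ (by rw [efType_fiber, efType_fiber]) ?_
    · intro p hp q hq
      refine block_lt_block (A := {i}) (B := A ∩ Ioi i) ?_ p (fiber_subset_block hp) q hq
      rintro a rfl b hb; exact hb.2
    · intro p hp q hq
      refine block_lt_block (A := {j}) (B := B ∩ Ioi j) ?_ p (fiber_subset_block hp) q hq
      rintro a rfl b hb; exact hb.2
    · rcases (A ∩ Ioi i).eq_empty_or_nonempty with h | h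
      · rw [h, not_nonempty_iff_eq_empty.1 (mt h₂.2 (not_nonempty_iff_eq_empty.2 h)), block_empty,
          block_empty]
        exact efType_empty m
      · rw [ihA _ (hA.inter_Ioi hi h), ihB _ (hB.inter_Ioi hj (h₂.1 h))]

theorem Icc_inter_Iio_nonempty {k : ℕ} {j : ℤ} (hj : j ∈ Icc (0 : ℤ) k) :
    (Icc (0 : ℤ) k ∩ Iio j).Nonempty ↔ 0 < j := by
  simp only [mem_Icc] at hj
  constructor
  · rintro ⟨l, hl⟩
    simp only [mem_inter_iff, mem_Icc, mem_Iio] at hl; lia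
  · intro h
    exact ⟨0, by simp only [mem_inter_iff, mem_Icc, mem_Iio]; lia⟩

theorem Icc_inter_Ioi_nonempty {k : ℕ} {j : ℤ} (hj : j ∈ Icc (0 : ℤ) k) :
    (Icc (0 : ℤ) k ∩ Ioi j).Nonempty ↔ j < k := by
  simp only [mem_Icc] at hj
  constructor
  · rintro ⟨l, hl⟩
    simp only [mem_inter_iff, mem_Icc, mem_Ioi] at hl; lia
  · intro h
    exact ⟨k, by simp only [mem_inter_iff, mem_Icc, mem_Ioi]; lia⟩

/-- The lexicographic product of a discrete order with endpoints and an idempotent order `J` has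
the same types as `J`. -/
theorem efType_block_int (hJ : IsIdempotentOrder J) {I : Type} [LinearOrder I] (m : ℕ) :
    (∀ A : Set ℤ, IsDiscreteWithEndpoints A → efType m (block J A) = efType m (univ : Set J)) ∧
    (∀ A : Set I, IsDiscreteWithEndpoints A → efType m (block J A) = efType m (univ : Set J)) := by
  induction m with
  | zero => exact ⟨fun _ _ => rfl, fun _ _ => rfl⟩
  | succ m ih =>
    -- `A` is compared with finite intervals of `ℤ`, whose blocks are known to have the type of `J`.
    -- Their cuts are subsets of `ℤ`, which is why the induction carries `ℤ` along with `I`.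
    have step {I : Type} [LinearOrder I] (ihI : ∀ A : Set I, IsDiscreteWithEndpoints A →
        efType m (block J A) = efType m (univ : Set J)) (A : Set I)
        (hA : IsDiscreteWithEndpoints A) :
        efType (m + 1) (block J A) = efType (m + 1) (univ : Set J) := by
      classical
      have hk (k : ℕ) := efType_succ_eq_iff.1 (efType_block_Icc hJ (m + 1) k)
      rw [efType_succ_eq_iff]
      constructor
      · intro x hx
        obtain ⟨⟨i, y⟩, rfl⟩ := toLex.surjective x
        replace hx : i ∈ A := hx
        -- An interval with at most three points contains a `j` with the same empty and nonempty
        -- sides as `i`.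
        obtain ⟨j, k, hjk, hj, hk'⟩ : ∃ (j : ℤ) (k : ℕ), j ∈ Icc (0 : ℤ) k ∧
            (0 < j ↔ (A ∩ Iio i).Nonempty) ∧ (j < k ↔ (A ∩ Ioi i).Nonempty) := by
          by_cases h₁ : (A ∩ Iio i).Nonempty <;> by_cases h₂ : (A ∩ Ioi i).Nonempty
          · exact ⟨1, 2, by simp, by simp [h₁], by simp [h₂]⟩
          · exact ⟨1, 1, by simp, by simp [h₁], by simp [h₂]⟩
          · exact ⟨0, 1, by simp, by simp [h₁], by simp [h₂]⟩
          · exact ⟨0, 0, by simp, by simp [h₁], by simp [h₂]⟩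
        obtain ⟨z, hz, e₁, e₂⟩ := (hk k).1 (toLex (j, y)) hjk
        have := efType_cut_eq hA (isDiscreteWithEndpoints_Icc k) ihI ih.1 hx hjk
          (by rw [Icc_inter_Iio_nonempty hjk, hj]) (by rw [Icc_inter_Ioi_nonempty hjk, hk']) y
        exact ⟨z, hz, this.1.trans e₁, this.2.trans e₂⟩
      · intro z hz
        obtain ⟨a, ha⟩ := hA.least
        obtain ⟨b, hb⟩ := hA.greatest
        -- Here `k` is fixed before `j` is known: `k` is `0`, `1` or `2` as `A` has one, two or more
        -- points, so that every `j` has a counterpart in `A`.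
        obtain ⟨k, h⟩ : ∃ k : ℕ, ∀ j ∈ Icc (0 : ℤ) k, ∃ i ∈ A,
            ((A ∩ Iio i).Nonempty ↔ 0 < j) ∧ ((A ∩ Ioi i).Nonempty ↔ j < k) := by
          have a₁ : ¬ (A ∩ Iio a).Nonempty := fun ⟨c, hc⟩ => (ha.2 hc.1).not_gt hc.2
          have b₁ : ¬ (A ∩ Ioi b).Nonempty := fun ⟨c, hc⟩ => (hb.2 hc.1).not_gt hc.2
          by_cases hab : a = b
          · subst hab
            refine ⟨0, fun j hj => ⟨a, ha.1, ?_⟩⟩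
            simp only [mem_Icc] at hj
            simp only [a₁, b₁, false_iff]
            lia
          have hlt : a < b := (ha.2 hb.1).lt_of_ne hab
          have a₂ : (A ∩ Ioi a).Nonempty := ⟨b, hb.1, hlt⟩
          have b₂ : (A ∩ Iio b).Nonempty := ⟨a, ha.1, hlt⟩
          by_cases hmid : ∃ c ∈ A, a < c ∧ c < b
          · obtain ⟨c, hc, hac, hcb⟩ := hmid
            refine ⟨2, fun j hj => ?_⟩
            simp only [mem_Icc, Nat.cast_ofNat] at hj
            obtain rfl | rfl | rfl : j = 0 ∨ j = 1 ∨ j = 2 := by lia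
            · exact ⟨a, ha.1, by simp [a₁], by simp [a₂]⟩
            · exact ⟨c, hc, iff_of_true ⟨a, ha.1, hac⟩ (by simp),
                iff_of_true ⟨b, hb.1, hcb⟩ (by simp)⟩
            · exact ⟨b, hb.1, by simp [b₂], by simp [b₁]⟩
          · refine ⟨1, fun j hj => ?_⟩
            simp only [mem_Icc, Nat.cast_one] at hj
            obtain rfl | rfl : j = 0 ∨ j = 1 := by lia
            · exact ⟨a, ha.1, by simp [a₁], by simp [a₂]⟩
            · exact ⟨b, hb.1, by simp [b₂], by simp [b₁]⟩
        obtain ⟨w, hjk, e₁, e₂⟩ := (hk k).2 z hz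
        obtain ⟨⟨j, y⟩, rfl⟩ := toLex.surjective w
        replace hjk : j ∈ Icc (0 : ℤ) k := hjk
        obtain ⟨i, hi, hi₁, hi₂⟩ := h j hjk
        have := efType_cut_eq hA (isDiscreteWithEndpoints_Icc k) ihI ih.1 hi hjk
          (by rw [Icc_inter_Iio_nonempty hjk, hi₁]) (by rw [Icc_inter_Ioi_nonempty hjk, hi₂]) y
        exact ⟨toLex (i, y), hi, this.1.trans e₁, this.2.trans e₂⟩
    exact ⟨step ih.1, step ih.2⟩

theorem efType_block (hJ : IsIdempotentOrder J) {I : Type} [LinearOrder I] (m : ℕ) {A : Set I}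
    (hA : IsDiscreteWithEndpoints A) : efType m (block J A) = efType m (univ : Set J) :=
  (efType_block_int hJ m).2 A hA

end Idempotent

end EhrenfeuchtFraisse

namespace EhrenfeuchtFraisse

open Set

/-! ### Similar tuples -/

section Sim

variable {α β ι ι' : Type*} [LinearOrder α] [LinearOrder β]

/-- The open interval between two optional endpoints. -/
def gap (o o' : Option α) : Set α := {x | (∀ a ∈ o, a < x) ∧ ∀ b ∈ o', x < b}

/-- The subtuples of `a` and `b` with indices in `F` are ordered in the same way, and the intervals
between their entries have the same types of rank `m`. -/
structure Sim (m : ℕ) (F : Set ι) (a : ι → α) (b : ι → β) : Prop where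
  lt_iff : ∀ i ∈ F, ∀ j ∈ F, a i < a j ↔ b i < b j
  gap_eq : ∀ o o' : Option ι, (∀ i ∈ o, i ∈ F) → (∀ i ∈ o', i ∈ F) →
    efType m (gap (o.map a) (o'.map a)) = efType m (gap (o.map b) (o'.map b))

namespace Sim

variable {m : ℕ} {F : Set ι} {a : ι → α} {b : ι → β}

theorem symm (h : Sim m F a b) : Sim m F b a :=
  ⟨fun i hi j hj => (h.lt_iff i hi j hj).symm, fun o o' ho ho' => (h.gap_eq o o' ho ho').symm⟩

theorem le_iff (h : Sim m F a b) {i j : ι} (hi : i ∈ F) (hj : j ∈ F) : a i ≤ a j ↔ b i ≤ b j := by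
  rw [← not_lt, ← not_lt, h.lt_iff j hj i hi]

theorem eq_iff (h : Sim m F a b) {i j : ι} (hi : i ∈ F) (hj : j ∈ F) : a i = a j ↔ b i = b j := by
  rw [le_antisymm_iff, le_antisymm_iff, h.le_iff hi hj, h.le_iff hj hi]

theorem of_succ (h : Sim (m + 1) F a b) : Sim m F a b :=
  ⟨h.lt_iff, fun o o' ho ho' => efType_eq_of_succ (h.gap_eq o o' ho ho')⟩

theorem of_le {n : ℕ} (hmn : m ≤ n) (h : Sim n F a b) : Sim m F a b := by
  induction hmn with
  | refl => exact h
  | step _ ih => exact ih h.of_succ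

theorem relabel {F' : Set ι'} (h : Sim m F a b) (g : ι' → ι) (hg : ∀ i ∈ F', g i ∈ F) :
    Sim m F' (a ∘ g) (b ∘ g) := by
  refine ⟨fun i hi j hj => h.lt_iff _ (hg i hi) _ (hg j hj), fun o o' ho ho' => ?_⟩
  have := h.gap_eq (o.map g) (o'.map g) (fun i hi => ?_) (fun i hi => ?_)
  · simpa only [Option.map_map] using this
  · obtain ⟨j, hj, rfl⟩ := Option.mem_map.1 hi
    exact hg j (ho j hj)
  · obtain ⟨j, hj, rfl⟩ := Option.mem_map.1 hi
    exact hg j (ho' j hj)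

end Sim

theorem gap_eq_empty {o o' : Option α} {x y : α} (hx : x ∈ o) (hy : y ∈ o') (h : y ≤ x) :
    gap o o' = ∅ :=
  eq_empty_of_forall_notMem fun _ hz => ((hz.1 x hx).trans (hz.2 y hy)).not_ge h

theorem gap_inter_Iio {o o' : Option α} {x : α} (hx : x ∈ gap o o') :
    gap o o' ∩ Iio x = gap o (some x) := by
  ext z
  simp only [gap, mem_inter_iff, mem_ofPred_eq, mem_Iio, Option.mem_some_iff, forall_eq']
  exact ⟨fun h => ⟨h.1.1, h.2⟩, fun h => ⟨⟨h.1, fun b hb => h.2.trans (hx.2 b hb)⟩, h.2⟩⟩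

theorem gap_inter_Ioi {o o' : Option α} {x : α} (hx : x ∈ gap o o') :
    gap o o' ∩ Ioi x = gap (some x) o' := by
  ext z
  simp only [gap, mem_inter_iff, mem_ofPred_eq, mem_Ioi, Option.mem_some_iff, forall_eq']
  exact ⟨fun h => ⟨h.2, h.1.2⟩, fun h => ⟨⟨fun b hb => (hx.1 b hb).trans h.1, h.2⟩, h.1⟩⟩

theorem gap_split {o o' : Option α} {x : α} (hx : x ∈ gap o o') :
    gap o o' = gap o (some x) ∪ ({x} ∪ gap (some x) o') := by
  ext z
  simp only [gap, mem_union, mem_ofPred_eq, mem_singleton_iff, Option.mem_some_iff, forall_eq']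
  constructor
  · intro h
    rcases lt_trichotomy z x with h' | h' | h'
    · exact Or.inl ⟨h.1, h'⟩
    · exact Or.inr (Or.inl h')
    · exact Or.inr (Or.inr ⟨h', h.2⟩)
  · rintro (h | rfl | h)
    · exact ⟨h.1, fun b hb => h.2.trans (hx.2 b hb)⟩
    · exact hx
    · exact ⟨fun b hb => (hx.1 b hb).trans h.1, h.2⟩

theorem efType_gap_split {m : ℕ} {o o' : Option α} {x : α} {p p' : Option β} {y : β}
    (hx : x ∈ gap o o') (hy : y ∈ gap p p')
    (h₁ : efType m (gap o (some x)) = efType m (gap p (some y)))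
    (h₂ : efType m (gap (some x) o') = efType m (gap (some y) p')) :
    efType m (gap o o') = efType m (gap p p') := by
  rw [gap_split hx, gap_split hy]
  refine efType_union ?_ ?_ h₁ (efType_union ?_ ?_ (efType_singleton m x y) h₂)
  · rintro u hu v (rfl | hv)
    · exact hu.2 _ rfl
    · exact (hu.2 _ rfl).trans (hv.1 _ rfl)
  · rintro u hu v (rfl | hv)
    · exact hu.2 _ rfl
    · exact (hu.2 _ rfl).trans (hv.1 _ rfl)
  · rintro u rfl v hv; exact hv.1 _ rfl
  · rintro u rfl v hv; exact hv.1 _ rfl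

/-- The index set `F`, extended by a new index. -/
def addIndex (F : Set ι) : Set (Option ι) := {o | ∀ i ∈ o, i ∈ F}

/-- The tuple `a`, extended by a new entry. -/
def addEntry (a : ι → α) (x : α) : Option ι → α := fun o => o.elim x a

/-- The new point `x` lies in the gap between its neighbours among the old entries, and the type of
this gap, of rank `m + 1`, provides `y`. Any other gap that ends at `x` is the ordered sum of an old
gap, a neighbour of `x` and a piece of the gap that was cut. -/
theorem Sim.extend {m : ℕ} {F : Set ι} {a : ι → α} {b : ι → β} (h : Sim (m + 1) F a b)
    (hF : F.Finite) (x : α) :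
    ∃ y : β, Sim m (addIndex F) (addEntry a x) (addEntry b y) := by
  by_cases hex : ∃ i ∈ F, a i = x
  · obtain ⟨i, hi, rfl⟩ := hex
    refine ⟨b i, ?_⟩
    have := h.of_succ.relabel (F' := addIndex F) (fun o => o.elim i id) fun o ho => by
      cases o with
      | none => exact hi
      | some j => exact ho j rfl
    convert this using 1 <;> · funext o; cases o <;> rfl
  push Not at hex
  -- the optional neighbours of `x`
  obtain ⟨o, hoF, hox, hmax⟩ : ∃ o : Option ι, (∀ i ∈ o, i ∈ F) ∧ (∀ i ∈ o, a i < x) ∧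
      ∀ i ∈ F, a i < x → ∃ j ∈ o, a i ≤ a j := by
    rcases {i ∈ F | a i < x}.eq_empty_or_nonempty with he | hne
    · refine ⟨none, by simp, by simp, fun i hi hix => ?_⟩
      exact (he.subset ⟨hi, hix⟩ : i ∈ (∅ : Set ι)).elim
    · obtain ⟨j, hj, hmax⟩ := Set.exists_max_image _ a (hF.sep _) hne
      exact ⟨some j, by simpa using hj.1, by simpa using hj.2,
        fun i hi hix => ⟨j, rfl, hmax i ⟨hi, hix⟩⟩⟩
  obtain ⟨o', hoF', hox', hmin⟩ : ∃ o : Option ι, (∀ i ∈ o, i ∈ F) ∧ (∀ i ∈ o, x < a i) ∧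
      ∀ i ∈ F, x < a i → ∃ j ∈ o, a j ≤ a i := by
    rcases {i ∈ F | x < a i}.eq_empty_or_nonempty with he | hne
    · refine ⟨none, by simp, by simp, fun i hi hix => ?_⟩
      exact (he.subset ⟨hi, hix⟩ : i ∈ (∅ : Set ι)).elim
    · obtain ⟨j, hj, hmin⟩ := Set.exists_min_image _ a (hF.sep _) hne
      exact ⟨some j, by simpa using hj.1, by simpa using hj.2,
        fun i hi hix => ⟨j, rfl, hmin i ⟨hi, hix⟩⟩⟩
  have hx : x ∈ gap (o.map a) (o'.map a) := by
    constructor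
    · intro c hc
      obtain ⟨i, hi, rfl⟩ := Option.mem_map.1 hc
      exact hox i hi
    · intro c hc
      obtain ⟨i, hi, rfl⟩ := Option.mem_map.1 hc
      exact hox' i hi
  obtain ⟨y, hy, e₁, e₂⟩ := (efType_succ_eq_iff.1 (h.gap_eq o o' hoF hoF')).1 x hx
  rw [gap_inter_Iio hx, gap_inter_Iio hy] at e₁
  rw [gap_inter_Ioi hx, gap_inter_Ioi hy] at e₂
  have lower {i : ι} (hi : i ∈ F) (hix : a i < x) : b i < y := by
    obtain ⟨j, hj, hij⟩ := hmax i hi hix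
    exact ((h.le_iff hi (hoF j hj)).1 hij).trans_lt (hy.1 _ (Option.mem_map_of_mem b hj))
  have upper {i : ι} (hi : i ∈ F) (hix : x < a i) : y < b i := by
    obtain ⟨j, hj, hij⟩ := hmin i hi hix
    exact (hy.2 _ (Option.mem_map_of_mem b hj)).trans_le ((h.le_iff (hoF' j hj) hi).1 hij)
  have lower_iff {i : ι} (hi : i ∈ F) : a i < x ↔ b i < y :=
    ⟨lower hi, fun hb => (lt_or_gt_of_ne (hex i hi)).resolve_right fun hxi =>
      (upper hi hxi).asymm hb⟩
  have upper_iff {i : ι} (hi : i ∈ F) : x < a i ↔ y < b i :=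
    ⟨upper hi, fun hb => (lt_or_gt_of_ne (hex i hi)).resolve_left fun hxi =>
      (lower hi hxi).asymm hb⟩
  have gap_lower (p : Option ι) (hp : ∀ i ∈ p, i ∈ F) :
      efType m (gap (p.map a) (some x)) = efType m (gap (p.map b) (some y)) := by
    by_cases hpx : ∃ i ∈ p, x < a i
    · obtain ⟨i, hi, hxi⟩ := hpx
      rw [gap_eq_empty (Option.mem_map_of_mem a hi) rfl hxi.le,
        gap_eq_empty (Option.mem_map_of_mem b hi) rfl (upper (hp i hi) hxi).le]
      exact efType_empty m
    have hpx' (i) (hi : i ∈ p) : a i < x :=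
      (lt_or_gt_of_ne (hex i (hp i hi))).resolve_right fun hxi => hpx ⟨i, hi, hxi⟩
    -- Either the gap starts at the lower neighbour of `x`, or it contains this neighbour and is
    -- split there.
    by_cases hpo : p.map a = o.map a
    · have : p.map b = o.map b := by
        cases p <;> cases o <;> simp at hpo ⊢
        exact (h.eq_iff (hp _ rfl) (hoF _ rfl)).1 hpo
      rw [hpo, this, e₁]
    · cases o with
      | none =>
        cases p with
        | none => exact (hpo rfl).elim
        | some i =>
          obtain ⟨j, hj, -⟩ := hmax i (hp i rfl) (hpx' i rfl)
          cases hj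
      | some j =>
        have hj : j ∈ F := hoF j rfl
        have hlt (i) (hi : i ∈ p) : a i < a j := by
          obtain ⟨k, hk, hik⟩ := hmax i (hp i hi) (hpx' i hi)
          cases hk
          refine hik.lt_of_ne fun hij => hpo ?_
          cases hi
          simp [hij]
        refine efType_gap_split (x := a j) (y := b j) ⟨?_, ?_⟩ ⟨?_, ?_⟩ ?_ e₁
        · intro c hc
          obtain ⟨i, hi, rfl⟩ := Option.mem_map.1 hc
          exact hlt i hi
        · rintro c ⟨⟩
          exact hox j rfl
        · intro c hc
          obtain ⟨i, hi, rfl⟩ := Option.mem_map.1 hc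
          exact (h.lt_iff _ (hp i hi) _ hj).1 (hlt i hi)
        · rintro c ⟨⟩
          exact lower hj (hox j rfl)
        · exact h.of_succ.gap_eq p (some j) hp hoF
  have gap_upper (p : Option ι) (hp : ∀ i ∈ p, i ∈ F) :
      efType m (gap (some x) (p.map a)) = efType m (gap (some y) (p.map b)) := by
    by_cases hpx : ∃ i ∈ p, a i < x
    · obtain ⟨i, hi, hxi⟩ := hpx
      rw [gap_eq_empty rfl (Option.mem_map_of_mem a hi) hxi.le,
        gap_eq_empty rfl (Option.mem_map_of_mem b hi) (lower (hp i hi) hxi).le]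
      exact efType_empty m
    have hpx' (i) (hi : i ∈ p) : x < a i :=
      (lt_or_gt_of_ne (hex i (hp i hi))).resolve_left fun hxi => hpx ⟨i, hi, hxi⟩
    by_cases hpo : p.map a = o'.map a
    · have : p.map b = o'.map b := by
        cases p <;> cases o' <;> simp at hpo ⊢
        exact (h.eq_iff (hp _ rfl) (hoF' _ rfl)).1 hpo
      rw [hpo, this, e₂]
    · cases o' with
      | none =>
        cases p with
        | none => exact (hpo rfl).elim
        | some i =>
          obtain ⟨j, hj, -⟩ := hmin i (hp i rfl) (hpx' i rfl)
          cases hj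
      | some j =>
        have hj : j ∈ F := hoF' j rfl
        have hlt (i) (hi : i ∈ p) : a j < a i := by
          obtain ⟨k, hk, hik⟩ := hmin i (hp i hi) (hpx' i hi)
          cases hk
          refine hik.lt_of_ne fun hij => hpo ?_
          cases hi
          simp [hij]
        refine efType_gap_split (x := a j) (y := b j) ⟨?_, ?_⟩ ⟨?_, ?_⟩ e₂ ?_
        · rintro c ⟨⟩
          exact hox' j rfl
        · intro c hc
          obtain ⟨i, hi, rfl⟩ := Option.mem_map.1 hc
          exact hlt i hi
        · rintro c ⟨⟩
          exact upper hj (hox' j rfl)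
        · intro c hc
          obtain ⟨i, hi, rfl⟩ := Option.mem_map.1 hc
          exact (h.lt_iff _ hj _ (hp i hi)).1 (hlt i hi)
        · exact h.of_succ.gap_eq (some j) p hoF' hp
  refine ⟨y, ⟨fun i hi j hj => ?_, fun p q hp hq => ?_⟩⟩
  · cases i <;> cases j
    · exact iff_of_false (lt_irrefl x) (lt_irrefl y)
    · exact upper_iff (hj _ rfl)
    · exact lower_iff (hi _ rfl)
    · exact h.lt_iff _ (hi _ rfl) _ (hj _ rfl)
  · have old (p : Option (Option ι)) (hp : ∀ i ∈ p, i ∈ addIndex F) (hne : p ≠ some none) :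
        ∃ p' : Option ι, (∀ i ∈ p', i ∈ F) ∧ p.map (addEntry a x) = p'.map a ∧
          p.map (addEntry b y) = p'.map b := by
      rcases p with _ | _ | i
      · exact ⟨none, by simp, rfl, rfl⟩
      · exact (hne rfl).elim
      · exact ⟨some i, hp _ rfl, rfl, rfl⟩
    by_cases hp' : p = some none <;> by_cases hq' : q = some none
    · subst hp' hq'
      change efType m (gap (some x) (some x)) = efType m (gap (some y) (some y))
      rw [gap_eq_empty (x := x) (y := x) rfl rfl le_rfl,
        gap_eq_empty (x := y) (y := y) rfl rfl le_rfl]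
      exact efType_empty m
    · subst hp'
      obtain ⟨q', h₁, h₂, h₃⟩ := old q hq hq'
      rw [h₂, h₃]
      exact gap_upper q' h₁
    · subst hq'
      obtain ⟨p', h₁, h₂, h₃⟩ := old p hp hp'
      rw [h₂, h₃]
      exact gap_lower p' h₁
    · obtain ⟨q', h₁, h₂, h₃⟩ := old q hq hq'
      obtain ⟨p', h₁', h₂', h₃'⟩ := old p hp hp'
      rw [h₂, h₃, h₂', h₃']
      exact h.of_succ.gap_eq _ _ h₁' h₁

end Sim

/-! ### Similar tuples in lexicographic products. -/

section SimLex

variable {J : Type u} [LinearOrder J] {I I' : Type} [LinearOrder I] [LinearOrder I'] {ι : Type*}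

theorem fiber_lt_of_lt {K L : Type*} [LinearOrder K] [LinearOrder L] {i : K} {A : Set K}
    (h : ∀ j ∈ A, i < j) {s : Set L} : ∀ p ∈ fiber i s, ∀ q ∈ block L A, p < q := fun p hp q hq =>
  block_lt_block (A := {i}) (B := A) (by rintro _ rfl; exact h) p (fiber_subset_block hp) q hq

theorem lt_fiber_of_lt {K L : Type*} [LinearOrder K] [LinearOrder L] {i : K} {A : Set K}
    (h : ∀ j ∈ A, j < i) {s : Set L} : ∀ p ∈ block L A, ∀ q ∈ fiber i s, p < q := fun p hp q hq =>
  block_lt_block (A := A) (B := {i}) (by rintro j hj _ rfl; exact h j hj) p hp q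
    (fiber_subset_block hq)

theorem gap_lex_Ioi {K L : Type*} [LinearOrder K] [LinearOrder L] (i : K) (x : L) :
    gap (some (toLex (i, x))) none = fiber i (Ioi x) ∪ block L (Ioi i) := by
  have := block_inter_Ioi (J := L) (univ : Set K) (mem_univ i) x
  rw [univ_inter] at this
  rw [← this]
  ext p
  simp [gap, block]

theorem gap_lex_Iio {K L : Type*} [LinearOrder K] [LinearOrder L] (i : K) (x : L) :
    gap none (some (toLex (i, x))) = block L (Iio i) ∪ fiber i (Iio x) := by
  have := block_inter_Iio (J := L) (univ : Set K) (mem_univ i) x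
  rw [univ_inter] at this
  rw [← this]
  ext p
  simp [gap, block]

theorem gap_lex_of_lt {K L : Type*} [LinearOrder K] [LinearOrder L] {i j : K} (hij : i < j)
    (x y : L) : gap (some (toLex (i, x))) (some (toLex (j, y))) =
      fiber i (Ioi x) ∪ (block L (Ioo i j) ∪ fiber j (Iio y)) := by
  ext p; obtain ⟨⟨k, z⟩, rfl⟩ := toLex.surjective p
  simp only [gap, Option.mem_some_iff, forall_eq', mem_ofPred_eq, Prod.Lex.toLex_lt_toLex,
    mem_union, mem_block, mem_fiber, mem_Ioo, mem_Ioi, mem_Iio]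
  constructor
  · rintro ⟨h | h, h' | h'⟩
    · exact Or.inr (Or.inl ⟨h, h'⟩)
    · exact Or.inr (Or.inr h')
    · exact Or.inl ⟨h.1.symm, h.2⟩
    · exact (hij.ne (h.1.trans h'.1)).elim
  · rintro (⟨rfl, h⟩ | h | ⟨rfl, h⟩)
    · exact ⟨Or.inr ⟨rfl, h⟩, Or.inl hij⟩
    · exact ⟨Or.inl h.1, Or.inl h.2⟩
    · exact ⟨Or.inl hij, Or.inr ⟨rfl, h⟩⟩

theorem gap_lex_same {K L : Type*} [LinearOrder K] [LinearOrder L] (i : K) (x y : L) :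
    gap (some (toLex (i, x))) (some (toLex (i, y))) = fiber i (Ioo x y) := by
  ext p; obtain ⟨⟨k, z⟩, rfl⟩ := toLex.surjective p
  simp only [gap, Option.mem_some_iff, forall_eq', mem_ofPred_eq, Prod.Lex.toLex_lt_toLex,
    mem_fiber, mem_Ioo]
  constructor
  · rintro ⟨h | h, h' | h'⟩
    · exact (h.asymm h').elim
    · exact (h.ne h'.1.symm).elim
    · exact (h'.ne h.1.symm).elim
    · exact ⟨h'.1, h.2, h'.2⟩
  · rintro ⟨rfl, h⟩
    exact ⟨Or.inr ⟨rfl, h.1⟩, Or.inr ⟨rfl, h.2⟩⟩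

/-- Every nonempty block has the type of `J`, so the sizes of `A` and `B` are invisible. -/
theorem efType_block_eq (hJ : IsIdempotentOrder J) (m : ℕ) {A : Set I} {B : Set I'}
    (hA : A.Nonempty → IsDiscreteWithEndpoints A) (hB : B.Nonempty → IsDiscreteWithEndpoints B)
    (h : A.Nonempty ↔ B.Nonempty) : efType m (block J A) = efType m (block J B) := by
  rcases A.eq_empty_or_nonempty with he | he
  · rw [he, not_nonempty_iff_eq_empty.1 (mt h.2 (not_nonempty_iff_eq_empty.2 he)), block_empty,
      block_empty]
    exact efType_empty m
  · rw [efType_block hJ m (hA he), efType_block hJ m (hB (h.1 he))]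

/-- In lexicographic products of discrete orders with endpoints with an idempotent order, tuples
with the same second coordinates are similar if their first coordinates are ordered in the same way
and have the same adjacencies. -/
theorem sim_lex (hJ : IsIdempotentOrder J) (hI : IsDiscreteWithEndpoints (univ : Set I))
    (hI' : IsDiscreteWithEndpoints (univ : Set I')) {F : Set ι} (s : ι → I) (s' : ι → I')
    (x : ι → J) (h₁ : ∀ i ∈ F, ∀ j ∈ F, s i < s j ↔ s' i < s' j)
    (h₂ : ∀ i ∈ F, ∀ j ∈ F, (Ioo (s i) (s j)).Nonempty ↔ (Ioo (s' i) (s' j)).Nonempty)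
    (h₃ : ∀ i ∈ F, (Iio (s i)).Nonempty ↔ (Iio (s' i)).Nonempty)
    (h₄ : ∀ i ∈ F, (Ioi (s i)).Nonempty ↔ (Ioi (s' i)).Nonempty) (m : ℕ) :
    Sim m F (fun i => toLex (s i, x i)) (fun i => toLex (s' i, x i)) := by
  have Ioi_disc {I : Type} [LinearOrder I] (hI : IsDiscreteWithEndpoints (univ : Set I)) (i : I)
      (hne : (Ioi i).Nonempty) : IsDiscreteWithEndpoints (Ioi i) := by
    have := hI.inter_Ioi (mem_univ i)
    rw [univ_inter] at this; exact this hne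
  have Iio_disc {I : Type} [LinearOrder I] (hI : IsDiscreteWithEndpoints (univ : Set I)) (i : I)
      (hne : (Iio i).Nonempty) : IsDiscreteWithEndpoints (Iio i) := by
    have := hI.inter_Iio (mem_univ i)
    rw [univ_inter] at this; exact this hne
  have Ioo_disc {I : Type} [LinearOrder I] (hI : IsDiscreteWithEndpoints (univ : Set I)) (i j : I)
      (hne : (Ioo i j).Nonempty) : IsDiscreteWithEndpoints (Ioo i j) := by
    obtain ⟨k, hk⟩ := hne
    exact (Ioi_disc hI i ⟨k, hk.1⟩).inter_Iio (i := j) (hk.1.trans hk.2) ⟨k, hk⟩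
  have eq_iff {i j} (hi : i ∈ F) (hj : j ∈ F) : s i = s j ↔ s' i = s' j := by
    rw [eq_iff_le_not_lt, eq_iff_le_not_lt, ← not_lt, ← not_lt, h₁ i hi j hj, h₁ j hj i hi]
  refine ⟨fun i hi j hj => ?_, fun o o' ho ho' => ?_⟩
  · rw [Prod.Lex.toLex_lt_toLex, Prod.Lex.toLex_lt_toLex]
    simp only [h₁ i hi j hj, eq_iff hi hj]
  · rcases o with _ | i <;> rcases o' with _ | j
    · have : (gap none none : Set (I ×ₗ J)) = block J univ := by ext p; simp [gap, block]
      have h' : (gap none none : Set (I' ×ₗ J)) = block J univ := by ext p; simp [gap, block]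
      simp only [Option.map_none]
      rw [this, h', efType_block hJ m hI, efType_block hJ m hI']
    · simp only [Option.map_none, Option.map_some]
      rw [gap_lex_Iio, gap_lex_Iio]
      refine efType_union (lt_fiber_of_lt fun _ h => h) (lt_fiber_of_lt fun _ h => h)
        (efType_block_eq hJ m (Iio_disc hI _) (Iio_disc hI' _) (h₃ j (ho' j rfl))) ?_
      rw [efType_fiber, efType_fiber]
    · simp only [Option.map_none, Option.map_some]
      rw [gap_lex_Ioi, gap_lex_Ioi]
      refine efType_union (fiber_lt_of_lt fun _ h => h) (fiber_lt_of_lt fun _ h => h) ?_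
        (efType_block_eq hJ m (Ioi_disc hI _) (Ioi_disc hI' _) (h₄ i (ho i rfl)))
      rw [efType_fiber, efType_fiber]
    · have hi := ho i rfl
      have hj := ho' j rfl
      simp only [Option.map_some]
      rcases lt_trichotomy (s i) (s j) with h | h | h
      · have h' := (h₁ i hi j hj).1 h
        -- The gap consists of the end of one fiber, the block over the points strictly between, and
        -- the beginning of another fiber. The fiber parts agree since the second coordinates do,
        -- and the blocks agree by the adjacency hypothesis.
        rw [gap_lex_of_lt h, gap_lex_of_lt h']
        refine efType_union ?_ ?_ (by rw [efType_fiber, efType_fiber])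
          (efType_union (lt_fiber_of_lt fun _ h => h.2) (lt_fiber_of_lt fun _ h => h.2)
            (efType_block_eq hJ m (Ioo_disc hI _ _) (Ioo_disc hI' _ _) (h₂ i hi j hj))
            (by rw [efType_fiber, efType_fiber]))
        · refine fun p hp q hq => fiber_lt_of_lt (A := Ioi (s i)) (fun _ h => h) p hp q ?_
          rcases hq with hq | hq
          · exact hq.1
          · exact h.trans_eq (show (ofLex q).1 = s j from fiber_subset_block hq).symm
        · refine fun p hp q hq => fiber_lt_of_lt (A := Ioi (s' i)) (fun _ h => h) p hp q ?_
          rcases hq with hq | hq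
          · exact hq.1
          · exact h'.trans_eq (show (ofLex q).1 = s' j from fiber_subset_block hq).symm
      · rw [h, (eq_iff hi hj).1 h, gap_lex_same, gap_lex_same, efType_fiber, efType_fiber]
      · have h' := (h₁ j hj i hi).1 h
        rw [gap_eq_empty rfl rfl (Prod.Lex.toLex_lt_toLex.2 (Or.inl h)).le,
          gap_eq_empty rfl rfl (Prod.Lex.toLex_lt_toLex.2 (Or.inl h')).le]
        exact efType_empty m

end SimLex

end EhrenfeuchtFraisse

/-! ### The structure of circles and back-and-forth for its formulas. -/

namespace CircleStructure

open Set FirstOrder.Language EhrenfeuchtFraisse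

/-- One binary relation for every natural number. -/
inductive ArcRel : ℕ → Type u
  | arc (n : ℕ) : ArcRel 2

/-- The language with a binary relation for every natural number. -/
def circleLang : FirstOrder.Language.{u, u} := ⟨fun _ => PEmpty, ArcRel⟩

/-- The relation symbol with index `n`. -/
def arc (n : ℕ) : circleLang.{u}.Relations 2 := ArcRel.arc n

/-- A disjoint union of circles: for every `n`, the `n + 1` copies of the order `α` labelled by
`c n 0, …, c n n` are arranged cyclically. -/
@[ext]
structure Circles (α : Type u) {Λ : Type u} (c : (n : ℕ) → ZMod (n + 1) → Λ) : Type u where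
  /-- The position of a point in its copy of the order. -/
  pos : α
  /-- The label of the copy of the order in which a point lies. -/
  label : Λ

section

variable {α β Λ : Type u} [LinearOrder α] [LinearOrder β] {c : (n : ℕ) → ZMod (n + 1) → Λ}

/-- The point `y` of the `n`-th circle lies on the arc that starts at `x` and ends just before the
next copy of `x`. -/
def IsArc (n : ℕ) (x y : Circles α c) : Prop :=
  ∃ i j : ZMod (n + 1), x.label = c n i ∧ y.label = c n j ∧
    (i = j ∧ x.pos ≤ y.pos ∨ j = i + 1 ∧ y.pos < x.pos)

instance : circleLang.{u}.Structure (Circles α c) where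
  funMap f := f.elim
  RelMap {k} r := match k, r with
    | _, ArcRel.arc n => fun v => IsArc n (v 0) (v 1)

theorem relMap_arc {n : ℕ} {v : Fin 2 → Circles α c} :
    Structure.RelMap (arc.{u} n) v ↔ IsArc n (v 0) (v 1) := Iff.rfl

theorem term_eq_var {ι : Type*} (t : circleLang.{u}.Term ι) : ∃ k, t = Term.var k := by
  cases t with
  | var k => exact ⟨k, rfl⟩
  | func f _ => exact f.elim

theorem exists_insert_range {ι : Type*} {n : ℕ} (k : ι ⊕ Fin n) : ∃ F : Set ι, F.Finite ∧
    k ∈ Sum.inl '' F ∪ range (Sum.inr : Fin n → ι ⊕ Fin n) := by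
  cases k with
  | inl i => exact ⟨{i}, finite_singleton i, by simp⟩
  | inr i => exact ⟨∅, finite_empty, by simp⟩

/-- Tuples with the same labels and sufficiently similar positions satisfy the same formulas. -/
theorem exists_realize_iff_of_sim {ι : Type*} {n : ℕ} (φ : circleLang.{u}.BoundedFormula ι n) :
    ∃ F : Set ι, F.Finite ∧ ∃ m : ℕ,
      ∀ (v : ι → Circles α c) (v' : ι → Circles β c) (x : Fin n → Circles α c)
        (x' : Fin n → Circles β c), (∀ k, (Sum.elim v x k).label = (Sum.elim v' x' k).label) →
        Sim m (Sum.inl '' F ∪ range Sum.inr) (fun k => (Sum.elim v x k).pos)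
          (fun k => (Sum.elim v' x' k).pos) →
        (φ.Realize v x ↔ φ.Realize v' x') := by
  induction φ with
  | falsum => exact ⟨∅, finite_empty, 0, fun _ _ _ _ _ _ => Iff.rfl⟩
  | equal t₁ t₂ =>
    obtain ⟨k₁, rfl⟩ := term_eq_var t₁
    obtain ⟨k₂, rfl⟩ := term_eq_var t₂
    obtain ⟨F₁, hF₁, h₁⟩ := exists_insert_range k₁
    obtain ⟨F₂, hF₂, h₂⟩ := exists_insert_range k₂
    refine ⟨F₁ ∪ F₂, hF₁.union hF₂, 0, fun v v' x x' hl hs => ?_⟩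
    have := hs.eq_iff (i := k₁) (j := k₂) (by simp only [image_union]; grind)
      (by simp only [image_union]; grind)
    refine Circles.ext_iff.trans (Iff.trans (and_congr this ?_) Circles.ext_iff.symm)
    have e₁ := hl k₁
    have e₂ := hl k₂
    exact ⟨fun h => e₁.symm.trans (h.trans e₂), fun h => e₁.trans (h.trans e₂.symm)⟩
  | rel R ts =>
    rcases R with ⟨n⟩
    obtain ⟨k₁, hk₁⟩ := term_eq_var (ts 0)
    obtain ⟨k₂, hk₂⟩ := term_eq_var (ts 1)
    obtain ⟨F₁, hF₁, h₁⟩ := exists_insert_range k₁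
    obtain ⟨F₂, hF₂, h₂⟩ := exists_insert_range k₂
    refine ⟨F₁ ∪ F₂, hF₁.union hF₂, 0, fun v v' x x' hl hs => ?_⟩
    have m₁ : k₁ ∈ Sum.inl '' (F₁ ∪ F₂) ∪ range Sum.inr := by simp only [image_union]; grind
    have m₂ : k₂ ∈ Sum.inl '' (F₁ ∪ F₂) ∪ range Sum.inr := by simp only [image_union]; grind
    have key : ∀ {γ : Type u} [LinearOrder γ] (w : _ → Circles γ c) (z : _ → Circles γ c),
        (BoundedFormula.rel (arc.{u} n) ts).Realize w z ↔
          IsArc n (Sum.elim w z k₁) (Sum.elim w z k₂) := by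
      intro γ _ w z
      refine relMap_arc.trans ?_
      rw [hk₁, hk₂]; rfl
    refine (key v x).trans (Iff.trans ?_ (key v' x').symm)
    have e₁ := hl k₁
    have e₂ := hl k₂
    have l₁ := hs.le_iff m₁ m₂
    have l₂ := hs.lt_iff _ m₂ _ m₁
    simp only [IsArc, e₁, e₂, l₁, l₂]
  | imp _ _ ih₁ ih₂ =>
    obtain ⟨F₁, hF₁, m₁, h₁⟩ := ih₁
    obtain ⟨F₂, hF₂, m₂, h₂⟩ := ih₂
    refine ⟨F₁ ∪ F₂, hF₁.union hF₂, max m₁ m₂, fun v v' x x' hl hs => ?_⟩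
    exact imp_congr
      (h₁ v v' x x' hl ((hs.of_le (le_max_left _ _)).relabel id (by simp only [image_union]; grind)))
      (h₂ v v' x x' hl ((hs.of_le (le_max_right _ _)).relabel id (by simp only [image_union]; grind)))
  | @all n φ ih =>
    obtain ⟨F, hF, m, h⟩ := ih
    -- The last bound variable is sent to `none`, the index of the new entry in `addEntry`.
    let g (k : ι ⊕ Fin (n + 1)) : Option (ι ⊕ Fin n) :=
      Sum.elim (fun i => some (Sum.inl i)) (Fin.snoc (fun i => some (Sum.inr i)) none) k
    have elim_snoc {X : Type u} (v : ι → X) (x : Fin n → X) (y : X) (k : ι ⊕ Fin (n + 1)) :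
        Sum.elim v (Fin.snoc x y : Fin (n + 1) → X) k = (g k).elim y (Sum.elim v x) := by
      rcases k with i | i
      · rfl
      · induction i using Fin.lastCases <;> simp [g]
    have hg : ∀ k ∈ Sum.inl '' F ∪ range Sum.inr,
        g k ∈ addIndex (Sum.inl '' F ∪ range (Sum.inr : Fin n → ι ⊕ Fin n)) := by
      rintro k (⟨i, hi, rfl⟩ | ⟨i, rfl⟩)
      · rintro _ ⟨⟩; exact Or.inl ⟨i, hi, rfl⟩
      · induction i using Fin.lastCases with
        | last => simp [g, addIndex]
        | cast i => simp [g, addIndex]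
    have fin : (Sum.inl '' F ∪ range (Sum.inr : Fin n → ι ⊕ Fin n)).Finite :=
      (hF.image _).union (finite_range _)
    have conv (γ δ : Type u) [LinearOrder γ] [LinearOrder δ] (v : ι → Circles γ c)
        (v' : ι → Circles δ c) (x : Fin n → Circles γ c) (x' : Fin n → Circles δ c)
        (hl : ∀ k, (Sum.elim v x k).label = (Sum.elim v' x' k).label) (y : Circles γ c) (z : δ)
        (hz : Sim m (addIndex (Sum.inl '' F ∪ range Sum.inr))
          (addEntry (fun k => (Sum.elim v x k).pos) y.pos)
          (addEntry (fun k => (Sum.elim v' x' k).pos) z)) :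
        (∀ k, (Sum.elim v (Fin.snoc x y : Fin (n + 1) → Circles γ c) k).label =
          (Sum.elim v' (Fin.snoc x' ⟨z, y.label⟩ : Fin (n + 1) → Circles δ c) k).label) ∧
        Sim m (Sum.inl '' F ∪ range Sum.inr)
          (fun k => (Sum.elim v (Fin.snoc x y : Fin (n + 1) → Circles γ c) k).pos)
          (fun k => (Sum.elim v' (Fin.snoc x' ⟨z, y.label⟩ : Fin (n + 1) → Circles δ c) k).pos) := by
      constructor
      · intro k
        rw [elim_snoc, elim_snoc]
        cases g k with
        | none => rfl
        | some k => exact hl k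
      · convert hz.relabel g hg using 1 <;>
        · funext k
          rw [elim_snoc]
          simp only [Function.comp, addEntry]
          cases g k <;> rfl
    -- A quantifier costs one rank. The answer to a point takes over its label, and its position
    -- comes from `Sim.extend`.
    refine ⟨F, hF, m + 1, fun v v' x x' hl hs => ⟨fun hφ y' => ?_, fun hφ y => ?_⟩⟩
    · obtain ⟨z, hz⟩ := hs.symm.extend fin y'.pos
      obtain ⟨e₁, e₂⟩ := conv β α v' v x' x (fun k => (hl k).symm) y' z hz
      exact (h v v' _ _ (fun k => (e₁ k).symm) e₂.symm).1 (hφ ⟨z, y'.label⟩)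
    · obtain ⟨z, hz⟩ := hs.extend fin y.pos
      obtain ⟨e₁, e₂⟩ := conv α β v v' x x' hl y z hz
      exact (h v v' _ _ e₁ e₂).2 (hφ ⟨z, y.label⟩)

theorem realize_iff_of_forall_sim {ι : Type*} (φ : circleLang.{u}.Formula ι)
    {v : ι → Circles α c} {v' : ι → Circles β c} (hl : ∀ k, (v k).label = (v' k).label)
    (hs : ∀ (F : Set ι) (m : ℕ), Sim m F (fun k => (v k).pos) (fun k => (v' k).pos)) :
    φ.Realize v ↔ φ.Realize v' := by
  obtain ⟨F, -, m, h⟩ := exists_realize_iff_of_sim (α := α) (β := β) (c := c) φ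
  refine h v v' default default ?_ ?_
  · rintro (k | k)
    · exact hl k
    · exact k.elim0
  · convert (hs F m).relabel (F' := Sum.inl '' F ∪ range Sum.inr)
      (fun k : ι ⊕ Fin 0 => k.elim id Fin.elim0) ?_ using 1
    · funext k
      rcases k with k | k
      · rfl
      · exact k.elim0
    · funext k
      rcases k with k | k
      · rfl
      · exact k.elim0
    · rintro _ (⟨i, hi, rfl⟩ | ⟨i, -⟩)
      · exact hi
      · exact i.elim0

end

end CircleStructure

namespace LascarDistance

open Set FirstOrder.Language Cardinal

variable {L : FirstOrder.Language.{u, u}}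

/-! ### Elementary embeddings and Lascar distance -/

section Elementary

theorem eqTypeOver_range {M K B : Type u} [L.Structure M] (e : B → M) {a b : K → M}
    (h : ∀ φ : L.Formula (B ⊕ K), φ.Realize (Sum.elim e a) ↔ φ.Realize (Sum.elim e b)) :
    EqTypeOver L (range e) a b := by
  intro φ
  choose g hg using fun x : range e => x.2
  have := h (φ.relabel (Sum.map g id))
  simp only [Formula.realize_relabel, Sum.elim_comp_map, Function.comp_id] at this
  have e₁ : e ∘ g = fun x : range e => (x : M) := funext hg
  rwa [e₁] at this

variable {A M : Type u} [L.Structure A] [L.Structure M]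

/-- The range of an elementary embedding, as an elementary substructure. -/
def elementaryRange (e : A ↪ₑ[L] M) : L.ElementarySubstructure M where
  toSubstructure := e.toHom.range
  isElementary' := by
    intro n φ x
    let g := e.toEmbedding.equivRange
    have h : ((↑) : e.toHom.range → M) ∘ x = e ∘ (g.symm ∘ x) := by
      funext i
      have : x i = g (g.symm (x i)) := (g.apply_symm_apply _).symm
      exact congrArg Subtype.val this
    have h' : x = g ∘ (g.symm ∘ x) := by
      funext i
      exact (g.apply_symm_apply _).symm
    have h₁ := e.map_formula φ (g.symm ∘ x)
    have h₂ := g.toElementaryEmbedding.map_formula φ (g.symm ∘ x)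
    rw [show (g.toElementaryEmbedding : A → _) ∘ (g.symm ∘ x) = x from h'.symm] at h₂
    rw [h]
    exact h₁.trans h₂.symm

theorem coe_elementaryRange (e : A ↪ₑ[L] M) : (elementaryRange e : Set M) = range e := by
  ext x
  exact Iff.rfl

theorem EqTypeOver.map {K : Type u} {a b : K → A} (S : L.ElementarySubstructure A)
    (h : EqTypeOver L (S : Set A) a b) (e : A ↪ₑ[L] M) :
    EqTypeOver L (elementaryRange (e.comp S.subtype) : Set M) (e ∘ a) (e ∘ b) := by
  rw [coe_elementaryRange]
  refine eqTypeOver_range _ fun φ => ?_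
  have key (a : K → A) : Sum.elim (⇑(e.comp S.subtype)) (e ∘ a) =
      e ∘ Sum.elim (fun x : S => (x : A)) a := by
    funext k; cases k <;> rfl
  rw [key, key, e.map_formula, e.map_formula]
  exact h φ

theorem LascarDistLE.map {K : Type u} {n : ℕ} {a b : K → A} (h : LascarDistLE L n a b)
    (e : A ↪ₑ[L] M) : LascarDistLE L n (e ∘ a) (e ∘ b) := by
  obtain ⟨c, rfl, rfl, h⟩ := h
  exact ⟨fun i => e ∘ c i, rfl, rfl, fun i hi => by
    obtain ⟨S, hS⟩ := h i hi
    exact ⟨_, EqTypeOver.map S hS e⟩⟩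

/-- The inclusion of elementary substructures, as an elementary embedding. -/
def elementaryInclusion {S N : L.ElementarySubstructure M} (h : (S : Set M) ⊆ N) :
    S ↪ₑ[L] N where
  toFun := Set.inclusion h
  map_formula' n φ x := by
    have h₁ := S.subtype.map_formula φ x
    have h₂ := N.subtype.map_formula φ (Set.inclusion h ∘ x)
    exact h₂.symm.trans h₁

/-- The downward Löwenheim–Skolem theorem for countable languages. -/
theorem exists_countable_elementarySubstructure (hL : L.card ≤ ℵ₀) {s : Set M}
    (hs : s.Countable) : ∃ N : L.ElementarySubstructure M, s ⊆ N ∧ (N : Set M).Countable := by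
  rcases le_total #M ℵ₀ with h | h
  · have : Countable M := mk_le_aleph0_iff.1 h
    exact ⟨⊤, subset_univ _, to_countable _⟩
  · obtain ⟨N, hN, hc⟩ := exists_elementarySubstructure_card_eq L s (ℵ₀ : Cardinal.{u}) le_rfl
      (lift_le.2 hs.le_aleph0) (by simpa using hL) (lift_le.2 h)
    refine ⟨N, hN, ?_⟩
    rw [lift_inj] at hc
    exact le_aleph0_iff_set_countable.1 hc.le

/-- Equality of types over `S` restricts to `S'`, so the models that witness a Lascar distance can
be taken countable. -/
theorem exists_countable_elementarySubstructure_le (hL : L.card ≤ ℵ₀)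
    (S : L.ElementarySubstructure M) :
    ∃ S' : L.ElementarySubstructure M, (S' : Set M) ⊆ S ∧ (S' : Set M).Countable := by
  obtain ⟨N, -, hN⟩ := exists_countable_elementarySubstructure (M := S) hL (countable_empty)
  refine ⟨elementaryRange (S.subtype.comp N.subtype), ?_, ?_⟩
  · rw [coe_elementaryRange]
    rintro _ ⟨x, rfl⟩
    exact x.1.2
  · rw [coe_elementaryRange]
    have : Countable N := hN.to_subtype
    exact countable_range _

theorem EqTypeOver.mono {K : Type u} {B B' : Set M} (hB : B' ⊆ B) {a b : K → M}
    (h : EqTypeOver L B a b) : EqTypeOver L B' a b := by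
  intro φ
  have := h (φ.relabel (Sum.map (Set.inclusion hB) id))
  simp only [Formula.realize_relabel, Sum.elim_comp_map, Function.comp_id] at this
  exact this

/-- Countably many bounds on Lascar distances hold in a countable elementary substructure. -/
theorem exists_countable_lascarDistLE (hL : L.card ≤ ℵ₀) {K : Type u} [Countable K] {a : K → M}
    {b : ℕ → K → M} {d : ℕ → ℕ} (h : ∀ t, LascarDistLE L (d t) a (b t)) :
    ∃ (N : L.ElementarySubstructure M) (a' : K → N) (b' : ℕ → K → N), Countable N ∧
      (∀ k, (a' k : M) = a k) ∧ (∀ t k, (b' t k : M) = b t k) ∧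
      ∀ t, LascarDistLE L (d t) a' (b' t) := by
  choose c hc₀ hc₁ hc using h
  choose! S hS using hc
  choose S' hS' hS'c using fun t i => exists_countable_elementarySubstructure_le hL (S t i)
  obtain ⟨N, hsN, hN⟩ := exists_countable_elementarySubstructure (M := M) hL
    (s := (⋃ t, ⋃ i, (S' t i : Set M)) ∪ range fun p : ℕ × ℕ × K => c p.1 p.2.1 p.2.2)
    ((countable_iUnion fun t => countable_iUnion fun i => hS'c t i).union (countable_range _))
  have memN (t i k) : c t i k ∈ N := hsN (Or.inr ⟨(t, i, k), rfl⟩)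
  have subN (t i) : (S' t i : Set M) ⊆ N := fun x hx =>
    hsN (Or.inl (mem_iUnion_of_mem t (mem_iUnion_of_mem i hx)))
  refine ⟨N, fun k => ⟨c 0 0 k, memN 0 0 k⟩, fun t k => ⟨c t (d t) k, memN t (d t) k⟩,
    hN.to_subtype, fun k => congrFun (hc₀ 0) k, fun t k => congrFun (hc₁ t) k,
    fun t => ?_⟩
  refine ⟨fun i k => ⟨c t i k, memN t i k⟩, ?_, rfl, fun i hi => ?_⟩
  · funext k
    exact Subtype.ext (by simp only [hc₀])
  · refine ⟨elementaryRange (elementaryInclusion (subN t i)), ?_⟩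
    rw [coe_elementaryRange]
    refine eqTypeOver_range _ fun φ => ?_
    have h₁ := EqTypeOver.mono (hS' t i) (hS t i hi) φ
    let w (i' : ℕ) : S' t i ⊕ K → N :=
      Sum.elim (elementaryInclusion (subN t i)) fun k => ⟨c t i' k, memN t i' k⟩
    have key (i' : ℕ) : N.subtype ∘ w i' = Sum.elim (fun x : S' t i => (x : M)) (c t i') := by
      funext k; cases k <;> rfl
    have h₂ (i' : ℕ) := N.subtype.map_formula φ (w i')
    simp only [key] at h₂
    exact (h₂ i).symm.trans (h₁.trans (h₂ (i + 1)))

end Elementary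

/-! ### Embedding countable structures in saturated ones -/

section Saturated

variable {N C : Type u} [L.Structure N] [L.Structure C]

/-- The tuples `a` and `b`, in possibly different structures, satisfy the same formulas. -/
def SameType {ι : Type} (a : ι → N) (b : ι → C) : Prop :=
  ∀ φ : L.Formula ι, φ.Realize a ↔ φ.Realize b

theorem SameType.eq_iff {ι : Type} {a : ι → N} {b : ι → C}
    (h : SameType (L := L) a b) (i j : ι) : a i = a j ↔ b i = b j := by
  have := h (Term.equal (Term.var i) (Term.var j))
  simpa [Formula.realize_equal] using this

/-- The type of `x` over `a`, with `a` replaced by `b`, is finitely satisfiable because each of its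
existential consequences transfers from `a` to `b`. Saturation realizes it. -/
theorem SameType.extend {κ : Cardinal.{u}} (hκ : ℵ₀ < κ) (hC : IsSaturated L κ C) {n : ℕ}
    {a : Fin n → N} {b : Fin n → C} (h : SameType (L := L) a b) (x : N) :
    ∃ y : C, SameType (L := L) (Fin.snoc a x : Fin (n + 1) → N) (Fin.snoc b y) := by
  classical
  -- Saturation takes a set of parameters, so each parameter gets an index. Repetitions in `b` do no
  -- harm, since `a` has the same ones.
  choose g hg using fun c : range b => c.2
  have hgb : b ∘ g = fun c : range b => (c : C) := funext hg
  obtain ⟨y, hy⟩ := hC (range b) ((lt_aleph0_of_finite _).trans hκ)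
    {φ | φ.Realize (Sum.elim (a ∘ g) fun _ => x)} (by
      intro q hq
      let ψ : L.Formula (range b ⊕ Unit) := Formula.iInf fun φ : q => φ.1
      have hψ : ((ψ.relabel (Sum.map g id)).iExs Unit).Realize a := by
        rw [Formula.realize_iExs]
        refine ⟨fun _ => x, ?_⟩
        rw [Formula.realize_relabel, Sum.elim_comp_map, Formula.realize_iInf]
        exact fun φ => hq φ.2
      rw [h, Formula.realize_iExs] at hψ
      obtain ⟨z, hz⟩ := hψ
      rw [Formula.realize_relabel, Sum.elim_comp_map, Formula.realize_iInf, hgb] at hz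
      exact ⟨z (), fun φ hφ => hz ⟨φ, hφ⟩⟩)
  refine ⟨y, fun φ => ?_⟩
  let r : Fin (n + 1) → range b ⊕ Unit :=
    Fin.snoc (fun i => Sum.inl ⟨b i, mem_range_self i⟩) (Sum.inr ())
  have e₁ : Sum.elim (a ∘ g) (fun _ => x) ∘ r = Fin.snoc a x := by
    funext i
    induction i using Fin.lastCases with
    | last => simp [r]
    | cast i =>
      simp only [r, Function.comp_apply, Fin.snoc_castSucc, Sum.elim_inl]
      exact (h.eq_iff _ _).2 (hg _)
  have e₂ : Sum.elim (fun c : range b => (c : C)) (fun _ => y) ∘ r = Fin.snoc b y := by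
    funext i
    induction i using Fin.lastCases <;> simp [r]
  have key (φ : L.Formula (Fin (n + 1))) (hφ : φ.Realize (Fin.snoc a x : Fin (n + 1) → N)) :
      φ.Realize (Fin.snoc b y : Fin (n + 1) → C) := by
    have := hy (φ.relabel r) (by
      change Formula.Realize _ _
      rw [Formula.realize_relabel, e₁]; exact hφ)
    rwa [Formula.realize_relabel, e₂] at this
  refine ⟨key φ, fun hφ => ?_⟩
  by_contra hn
  exact Formula.realize_not.1 (key φ.not (Formula.realize_not.2 hn)) hφ

/-- A countable structure embeds elementarily in every elementarily equivalent structure that is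
saturated for countable sets of parameters. -/
theorem exists_elementaryEmbedding [Countable N] [Nonempty N] {κ : Cardinal.{u}} (hκ : ℵ₀ < κ)
    (hC : IsSaturated L κ C) (h : ∀ φ : L.Sentence, N ⊨ φ ↔ C ⊨ φ) : Nonempty (N ↪ₑ[L] C) := by
  obtain ⟨e, he⟩ := exists_surjective_nat N
  have h₀ : SameType (L := L) (fun i : Fin 0 => e i) (Fin.elim0 : Fin 0 → C) := by
    intro φ
    have := h (φ.relabel (Fin.elim0 : Fin 0 → Empty))
    rw [Sentence.Realize, Sentence.Realize, Formula.realize_relabel, Formula.realize_relabel] at this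
    rwa [Subsingleton.elim ((default : Empty → N) ∘ Fin.elim0) (fun i : Fin 0 => e i),
      Subsingleton.elim ((default : Empty → C) ∘ Fin.elim0) Fin.elim0] at this
  let T (n : ℕ) := {b : Fin n → C // SameType (L := L) (fun i : Fin n => e i) b}
  have ext (n : ℕ) (t : T n) : ∃ t' : T (n + 1), ∀ i, t'.1 (Fin.castSucc i) = t.1 i := by
    obtain ⟨y, hy⟩ := t.2.extend hκ hC (e n)
    refine ⟨⟨Fin.snoc t.1 y, ?_⟩, fun i => by simp⟩
    convert hy using 1
    funext i
    induction i using Fin.lastCases <;> simp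
  choose f hf using ext
  let t (n : ℕ) : T n := Nat.rec (motive := T) ⟨Fin.elim0, h₀⟩ f n
  have ht (n : ℕ) (i : Fin n) : (t (n + 1)).1 (Fin.castSucc i) = (t n).1 i := hf n (t n) i
  -- The value at `e i` is fixed at stage `i + 1` and never changes, so the finite partial maps have
  -- a union.
  have ht' (n : ℕ) : ∀ i : Fin n, (t n).1 i = (t (i + 1)).1 (Fin.last i) := by
    induction n with
    | zero => exact fun i => i.elim0
    | succ n ih =>
      intro i
      induction i using Fin.lastCases with
      | last => rfl
      | cast i => rw [ht, ih]; rfl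
  choose g hg using he
  refine ⟨⟨fun x => (t (g x + 1)).1 (Fin.last (g x)), fun k φ x => ?_⟩⟩
  obtain ⟨n, hn⟩ : ∃ n, ∀ i, g (x i) < n := by
    refine ⟨(Finset.univ.sup fun i => g (x i)) + 1, fun i => Nat.lt_succ_of_le ?_⟩
    exact Finset.le_sup (f := fun i => g (x i)) (Finset.mem_univ i)
  have := (t n).2 (φ.relabel fun i => ⟨g (x i), hn i⟩)
  rw [Formula.realize_relabel, Formula.realize_relabel] at this
  convert this.symm using 1
  · rw [iff_iff_eq]; congr 1
    funext i
    simp only [Function.comp_apply]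
    rw [ht']
  · rw [iff_iff_eq]; congr 1
    funext i
    simp only [Function.comp_apply, hg]

end Saturated

end LascarDistance

namespace CircleStructure

open Set FirstOrder.Language EhrenfeuchtFraisse LascarDistance

/-! ### Circles with many symmetries -/

section Base

/-- The set of pairs of integers that satisfy `P`, ordered lexicographically. -/
abbrev LexSet (P : ℤ → ℤ → Prop) : Type := {w : ℤ ×ₗ ℤ // P (ofLex w).1 (ofLex w).2}

theorem LexSet.lt_iff {P : ℤ → ℤ → Prop} {x y : LexSet P} : x < y ↔
    (ofLex x.1).1 < (ofLex y.1).1 ∨ (ofLex x.1).1 = (ofLex y.1).1 ∧ (ofLex x.1).2 < (ofLex y.1).2 :=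
  Prod.Lex.lt_iff

theorem LexSet.le_iff {P : ℤ → ℤ → Prop} {x y : LexSet P} : x ≤ y ↔
    (ofLex x.1).1 < (ofLex y.1).1 ∨ (ofLex x.1).1 = (ofLex y.1).1 ∧ (ofLex x.1).2 ≤ (ofLex y.1).2 :=
  Prod.Lex.le_iff

theorem isDiscreteWithEndpoints_lexSet {P : ℤ → ℤ → Prop} (h₀ : P 0 0) (h₃ : P 3 (-1))
    (hP : ∀ q z, P q z → (0 < q ∨ q = 0 ∧ 0 ≤ z) ∧ (q < 3 ∨ q = 3 ∧ z < 0))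
    (hsucc : ∀ q z, P q z → ¬ (q = 3 ∧ z = -1) → P q (z + 1))
    (hpred : ∀ q z, P q z → ¬ (q = 0 ∧ z = 0) → P q (z - 1)) :
    IsDiscreteWithEndpoints (univ : Set (LexSet P)) where
  least := by
    refine ⟨⟨toLex (0, 0), h₀⟩, mem_univ _, fun x _ => LexSet.le_iff.2 ?_⟩
    have := hP _ _ x.2
    simp only [ofLex_toLex]
    lia
  greatest := by
    refine ⟨⟨toLex (3, -1), h₃⟩, mem_univ _, fun x _ => LexSet.le_iff.2 ?_⟩
    have := hP _ _ x.2
    simp only [ofLex_toLex]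
    lia
  succ := by
    rintro x - ⟨y, -, hxy⟩
    have hxy := LexSet.lt_iff.1 (mem_Ioi.1 hxy)
    have hy := hP _ _ y.2
    have hx := hP _ _ x.2
    refine ⟨⟨toLex ((ofLex x.1).1, (ofLex x.1).2 + 1), hsucc (ofLex x.1).1 (ofLex x.1).2 x.2
      (by lia)⟩,
      ⟨mem_univ _, LexSet.lt_iff.2 (Or.inr ⟨rfl, by simp⟩)⟩, fun w hw => LexSet.le_iff.2 ?_⟩
    have hw := LexSet.lt_iff.1 (mem_Ioi.1 hw.2)
    simp only [ofLex_toLex]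
    lia
  pred := by
    rintro x - ⟨y, -, hxy⟩
    have hxy := LexSet.lt_iff.1 (mem_Iio.1 hxy)
    have hy := hP _ _ y.2
    have hx := hP _ _ x.2
    refine ⟨⟨toLex ((ofLex x.1).1, (ofLex x.1).2 - 1), hpred (ofLex x.1).1 (ofLex x.1).2 x.2
      (by lia)⟩,
      ⟨mem_univ _, LexSet.lt_iff.2 (Or.inr ⟨rfl, by simp⟩)⟩, fun w hw => LexSet.le_iff.2 ?_⟩
    have hw := LexSet.lt_iff.1 (mem_Iio.1 hw.2)
    simp only [ofLex_toLex]
    lia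

/-- The condition that defines the discrete order `ω + ζ + ζ + ω*`. -/
abbrev InBase (q z : ℤ) : Prop := q = 0 ∧ 0 ≤ z ∨ q = 1 ∨ q = 2 ∨ q = 3 ∧ z < 0

/-- The condition that defines the discrete order `ω + ω*`. -/
abbrev InOuterBase (q z : ℤ) : Prop := q = 0 ∧ 0 ≤ z ∨ q = 3 ∧ z < 0

/-- The discrete order `ω + ζ + ζ + ω*`. -/
abbrev Base : Type := LexSet InBase

/-- The initial and the final segment of `Base`, of order type `ω + ω*`. -/
abbrev OuterBase : Type := LexSet InOuterBase

theorem isDiscreteWithEndpoints_base : IsDiscreteWithEndpoints (univ : Set Base) :=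
  isDiscreteWithEndpoints_lexSet (by lia) (by lia) (by lia) (by lia) (by lia)

theorem isDiscreteWithEndpoints_outerBase : IsDiscreteWithEndpoints (univ : Set OuterBase) :=
  isDiscreteWithEndpoints_lexSet (by lia) (by lia) (by lia) (by lia) (by lia)

/-- The inclusion of `OuterBase` in `Base`. -/
def OuterBase.incl (x : OuterBase) : Base := ⟨x.1, by have := x.2; lia⟩

/-- The points `(0, 0)`, `(1, 0)` and `(2, 0)` of `Base`. -/
def Base.pt (q : Fin 3) : Base := ⟨toLex ((q : ℤ), 0), by
  simp only [ofLex_toLex]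
  have := q.2
  lia⟩

/-- `1` if the rotation by a third of `Base` leads to the next copy of `Base`, otherwise `0`. -/
def Base.carry (x : Base) : ℕ :=
  if (ofLex x.1).1 = 2 ∧ 0 ≤ (ofLex x.1).2 ∨ (ofLex x.1).1 = 3 then 1 else 0

/-- The rotation by a third of `Base`. -/
def Base.rot (x : Base) : Base :=
  -- The `ω*` that ends one copy of `Base` and the `ω` that begins the next form a `ζ`. So each copy
  -- of `Base` accounts for three copies of `ζ`, and the rotation moves every `ζ` to the next one
  -- with `z` unchanged.
  ⟨toLex (if (ofLex x.1).1 = 2 ∧ 0 ≤ (ofLex x.1).2 ∨ (ofLex x.1).1 = 3 then (ofLex x.1).1 - 2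
    else (ofLex x.1).1 + 1, (ofLex x.1).2), by
    have := x.2
    simp only [ofLex_toLex]
    split_ifs <;> lia⟩

theorem Base.rot_lt_iff {x y : Base} (h : x.carry = y.carry) : x.rot < y.rot ↔ x < y := by
  have hx := x.2
  have hy := y.2
  simp only [Base.carry] at h
  rw [LexSet.lt_iff, LexSet.lt_iff]
  simp only [Base.rot, ofLex_toLex]
  split_ifs at h ⊢ <;> lia

/-- The points that carry form a final segment of `Base`, and the rotation exchanges it with the
initial segment of the others. -/
theorem Base.lt_of_carry {x y : Base} (hx₀ : x.carry = 0) (hy₀ : y.carry = 1) :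
    x < y ∧ y.rot < x.rot := by
  have hx := x.2
  have hy := y.2
  simp only [Base.carry] at hx₀ hy₀
  rw [LexSet.lt_iff, LexSet.lt_iff]
  simp only [Base.rot, ofLex_toLex]
  split_ifs at hx₀ hy₀ ⊢
  lia

theorem Base.carry_eq (x : Base) : x.carry = 0 ∨ x.carry = 1 := by
  simp only [Base.carry]; split_ifs <;> simp

theorem Base.rot_surjective : Function.Surjective Base.rot := by
  intro x
  have hx := x.2
  by_cases h : (ofLex x.1).1 = 0 ∨ (ofLex x.1).1 = 1 ∧ (ofLex x.1).2 < 0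
  · refine ⟨⟨toLex ((ofLex x.1).1 + 2, (ofLex x.1).2), by simp only [ofLex_toLex]; lia⟩, ?_⟩
    refine Subtype.ext (ofLex.injective (Prod.ext ?_ rfl))
    simp only [Base.rot, ofLex_toLex]
    split_ifs <;> lia
  · refine ⟨⟨toLex ((ofLex x.1).1 - 1, (ofLex x.1).2), by simp only [ofLex_toLex]; lia⟩, ?_⟩
    refine Subtype.ext (ofLex.injective (Prod.ext ?_ rfl))
    simp only [Base.rot, ofLex_toLex]
    split_ifs <;> lia

theorem Base.rot_pt_zero : (Base.pt 0).rot = Base.pt 1 ∧ (Base.pt 0).carry = 0 :=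
  ⟨rfl, rfl⟩

theorem Base.rot_pt_one : (Base.pt 1).rot = Base.pt 2 ∧ (Base.pt 1).carry = 0 :=
  ⟨rfl, rfl⟩

theorem Base.rot_pt_two : (Base.pt 2).rot = Base.pt 0 ∧ (Base.pt 2).carry = 1 :=
  ⟨rfl, rfl⟩

end Base

/-! ### Rotations of the circles as automorphisms. -/

section Rotation

variable {J Λ : Type u} {c : (n : ℕ) → ZMod (n + 1) → Λ}

/-- The rotation of positions. -/
def rotPos (p : Base ×ₗ J) : Base ×ₗ J := toLex ((ofLex p).1.rot, (ofLex p).2)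

/-- All labels `c n i` are different. -/
def LabelsInjective (c : (n : ℕ) → ZMod (n + 1) → Λ) : Prop :=
  Function.Injective fun p : Σ n : ℕ, ZMod (n + 1) => c p.1 p.2

theorem LabelsInjective.eq (hc : LabelsInjective c) {n m : ℕ} {i : ZMod (n + 1)}
    {j : ZMod (m + 1)} (h : c n i = c m j) : n = m := by
  have := @hc ⟨n, i⟩ ⟨m, j⟩ h
  exact congrArg Sigma.fst this

theorem LabelsInjective.injective (hc : LabelsInjective c) (n : ℕ) :
    Function.Injective (c n) := fun i j h => by
  have := @hc ⟨n, i⟩ ⟨n, j⟩ h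
  simpa using this

/-- The rotation of the `n`-th circle by a third of a copy of `Base`. -/
noncomputable def rotate (n : ℕ) (x : Circles (Base ×ₗ J) c) : Circles (Base ×ₗ J) c := by
  classical
  exact if h : ∃ l, c n l = x.label then
    ⟨rotPos x.pos, c n (h.choose + (ofLex x.pos).1.carry)⟩ else x

theorem rotate_mk (hc : LabelsInjective c) (n : ℕ) (p : Base ×ₗ J) (l : ZMod (n + 1)) :
    rotate n (⟨p, c n l⟩ : Circles (Base ×ₗ J) c) =
      ⟨rotPos p, c n (l + (ofLex p).1.carry)⟩ := by
  have h : ∃ l', c n l' = c n l := ⟨l, rfl⟩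
  have : h.choose = l := hc.injective n h.choose_spec
  rw [rotate, dif_pos h, this]

theorem rotate_of_forall_ne {n : ℕ} {x : Circles (Base ×ₗ J) c} (h : ∀ l, c n l ≠ x.label) :
    rotate n x = x := by
  rw [rotate, dif_neg (by simpa using h)]

theorem exists_label_rotate_iff (hc : LabelsInjective c) (n m : ℕ) (x : Circles (Base ×ₗ J) c) :
    (∃ i, c m i = (rotate n x).label) ↔ ∃ i, c m i = x.label := by
  obtain ⟨p, l⟩ := x
  by_cases hl : ∃ i, c n i = l
  · obtain ⟨i, rfl⟩ := hl
    rw [rotate_mk hc]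
    constructor
    · rintro ⟨j, hj⟩
      cases hc.eq hj
      exact ⟨i, rfl⟩
    · rintro ⟨j, hj⟩
      cases hc.eq hj
      exact ⟨_, rfl⟩
  · rw [rotate_of_forall_ne (by simpa using hl)]

variable [LinearOrder J]

theorem rotPos_lt_iff {p q : Base ×ₗ J} (h : (ofLex p).1.carry = (ofLex q).1.carry) :
    rotPos p < rotPos q ↔ p < q := by
  have h₁ := Base.rot_lt_iff h
  have h₂ := Base.rot_lt_iff h.symm
  have h₃ : (ofLex p).1.rot = (ofLex q).1.rot ↔ (ofLex p).1 = (ofLex q).1 := by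
    rw [eq_iff_le_not_lt, eq_iff_le_not_lt, ← not_lt, ← not_lt, h₁, h₂]
  rw [Prod.Lex.lt_iff, Prod.Lex.lt_iff]
  exact or_congr h₁ (and_congr h₃ Iff.rfl)

theorem rotPos_le_iff {p q : Base ×ₗ J} (h : (ofLex p).1.carry = (ofLex q).1.carry) :
    rotPos p ≤ rotPos q ↔ p ≤ q := by
  rw [← not_lt, ← not_lt, rotPos_lt_iff h.symm]

theorem lt_of_carry {p q : Base ×ₗ J} (hp : (ofLex p).1.carry = 0) (hq : (ofLex q).1.carry = 1) :
    p < q ∧ rotPos q < rotPos p :=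
  ⟨Prod.Lex.lt_iff.2 (Or.inl (Base.lt_of_carry hp hq).1),
    Prod.Lex.lt_iff.2 (Or.inl (Base.lt_of_carry hp hq).2)⟩

theorem rotPos_injective : Function.Injective (rotPos (J := J)) := by
  have aux {p q : Base ×ₗ J} (hp : (ofLex p).1.carry = 0) (hq : (ofLex q).1.carry = 1) :
      rotPos p ≠ rotPos q := (lt_of_carry hp hq).2.ne'
  intro p q h
  rcases (ofLex p).1.carry_eq with hp | hp <;> rcases (ofLex q).1.carry_eq with hq | hq
  · exact le_antisymm ((rotPos_le_iff (hp.trans hq.symm)).1 h.le)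
      ((rotPos_le_iff (hq.trans hp.symm)).1 h.ge)
  · exact (aux hp hq h).elim
  · exact (aux hq hp h.symm).elim
  · exact le_antisymm ((rotPos_le_iff (hp.trans hq.symm)).1 h.le)
      ((rotPos_le_iff (hq.trans hp.symm)).1 h.ge)

variable {α : Type u} [LinearOrder α]

theorem isArc_mk (hc : LabelsInjective c) {n : ℕ} {p q : α} {i j : ZMod (n + 1)} :
    IsArc n (⟨p, c n i⟩ : Circles α c) ⟨q, c n j⟩ ↔ i = j ∧ p ≤ q ∨ j = i + 1 ∧ q < p := by
  constructor
  · rintro ⟨i', j', hi, hj, h⟩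
    cases hc.injective n hi
    cases hc.injective n hj
    exact h
  · exact fun h => ⟨i, j, rfl, rfl, h⟩

theorem rotate_bijective (hc : LabelsInjective c) (n : ℕ) :
    Function.Bijective (rotate n : Circles (Base ×ₗ J) c → _) := by
  constructor
  · rintro ⟨p, l⟩ ⟨q, k⟩ h
    by_cases hl : ∃ i, c n i = l <;> by_cases hk : ∃ j, c n j = k
    · obtain ⟨i, rfl⟩ := hl
      obtain ⟨j, rfl⟩ := hk
      rw [rotate_mk hc, rotate_mk hc, Circles.mk.injEq] at h
      cases rotPos_injective h.1
      rw [add_right_cancel (hc.injective n h.2)]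
    · obtain ⟨i, rfl⟩ := hl
      rw [rotate_mk hc, rotate_of_forall_ne (by simpa using hk), Circles.mk.injEq] at h
      exact (hk ⟨_, h.2⟩).elim
    · obtain ⟨j, rfl⟩ := hk
      rw [rotate_mk hc, rotate_of_forall_ne (by simpa using hl), Circles.mk.injEq] at h
      exact (hl ⟨_, h.2.symm⟩).elim
    · rwa [rotate_of_forall_ne (by simpa using hl), rotate_of_forall_ne (by simpa using hk)] at h
  · rintro ⟨p, l⟩
    by_cases hl : ∃ i, c n i = l
    · obtain ⟨i, rfl⟩ := hl
      obtain ⟨b, hb⟩ := Base.rot_surjective (ofLex p).1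
      refine ⟨⟨toLex (b, (ofLex p).2), c n (i - b.carry)⟩, ?_⟩
      rw [rotate_mk hc]
      simp only [rotPos, ofLex_toLex, hb, sub_add_cancel]
      rfl
    · exact ⟨⟨p, l⟩, rotate_of_forall_ne (by simpa using hl)⟩

theorem IsArc.labels {n : ℕ} {x y : Circles α c} (h : IsArc n x y) :
    (∃ i, c n i = x.label) ∧ ∃ i, c n i = y.label := by
  obtain ⟨i, j, hi, hj, -⟩ := h
  exact ⟨⟨i, hi.symm⟩, ⟨j, hj.symm⟩⟩

/-- If both points carry or neither does, order and difference of labels are preserved. If just one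
carries, the order of the positions flips and the difference of labels changes by one, which
exchanges the two clauses of `IsArc`. -/
theorem isArc_rotate_iff (hc : LabelsInjective c) (n m : ℕ) (x y : Circles (Base ×ₗ J) c) :
    IsArc m (rotate n x) (rotate n y) ↔ IsArc m x y := by
  by_cases hx : ∃ i, c m i = x.label
  swap
  · exact iff_of_false (fun h => hx ((exists_label_rotate_iff hc n m x).1 h.labels.1))
      fun h => hx h.labels.1
  by_cases hy : ∃ i, c m i = y.label
  swap
  · exact iff_of_false (fun h => hy ((exists_label_rotate_iff hc n m y).1 h.labels.2))
      fun h => hy h.labels.2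
  by_cases hnm : n = m
  swap
  · rw [rotate_of_forall_ne, rotate_of_forall_ne]
    · intro l hl
      obtain ⟨i, hi⟩ := hy
      exact hnm (hc.eq (hl.trans hi.symm))
    · intro l hl
      obtain ⟨i, hi⟩ := hx
      exact hnm (hc.eq (hl.trans hi.symm))
  subst hnm
  obtain ⟨p, l⟩ := x
  obtain ⟨q, k⟩ := y
  obtain ⟨i, rfl⟩ := hx
  obtain ⟨j, rfl⟩ := hy
  rw [rotate_mk hc, rotate_mk hc, isArc_mk hc, isArc_mk hc]
  have same (h : (ofLex p).1.carry = (ofLex q).1.carry) :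
      (i + ((ofLex p).1.carry : ℕ) = j + ((ofLex q).1.carry : ℕ) ∧ rotPos p ≤ rotPos q ∨
        j + ((ofLex q).1.carry : ℕ) = i + ((ofLex p).1.carry : ℕ) + 1 ∧ rotPos q < rotPos p) ↔
      (i = j ∧ p ≤ q ∨ j = i + 1 ∧ q < p) := by
    rw [rotPos_le_iff h, rotPos_lt_iff h.symm, h]
    refine or_congr (and_congr_left' (add_left_inj _)) (and_congr_left' ?_)
    rw [add_right_comm, add_left_inj]
  rcases (ofLex p).1.carry_eq with hp | hp <;> rcases (ofLex q).1.carry_eq with hq | hq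
  · exact same (hp.trans hq.symm)
  · obtain ⟨h₁, h₂⟩ := lt_of_carry hp hq
    simp only [hp, hq, h₁.le, h₂, h₁.not_gt, h₂.not_ge, and_false, or_false, false_or, and_true,
      Nat.cast_zero, Nat.cast_one, add_zero, add_left_inj]
    exact eq_comm
  · obtain ⟨h₁, h₂⟩ := lt_of_carry hq hp
    simp only [hp, hq, h₁, h₁.not_ge, h₂.le, h₂.not_gt, and_false, or_false, false_or, and_true,
      Nat.cast_zero, Nat.cast_one, add_zero]
    exact eq_comm
  · exact same (hp.trans hq.symm)

/-- The rotation of the `n`-th circle, as an automorphism. -/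
noncomputable def rotateEquiv (hc : LabelsInjective c) (n : ℕ) :
    Circles (Base ×ₗ J) c ≃[circleLang.{u}] Circles (Base ×ₗ J) c where
  toEquiv := Equiv.ofBijective _ (rotate_bijective hc n)
  map_fun' f := f.elim
  map_rel' r x := by
    rcases r with ⟨m⟩
    exact isArc_rotate_iff hc n m (x 0) (x 1)

end Rotation

end CircleStructure

/-! ### Upper bounds: Lascar chains made of rotations. -/

namespace CircleStructure

open Set FirstOrder.Language EhrenfeuchtFraisse LascarDistance

section LascarChain

variable {J Λ : Type u} {c : (n : ℕ) → ZMod (n + 1) → Λ}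

/-- The tuple of points over `y`, one in every circle, where the point in the `n`-th circle is the
point with label `l` over the point `(q, 0)` of `Base`, and the others are over `(0, 0)`. -/
def tuple (c : (n : ℕ) → ZMod (n + 1) → Λ) (y : J) (n : ℕ) (q : Fin 3) (l : ZMod (n + 1)) :
    ULift.{u} ℕ → Circles (Base ×ₗ J) c := fun j =>
  if j.down = n then ⟨toLex (Base.pt q, y), c n l⟩ else ⟨toLex (Base.pt 0, y), c j.down 0⟩

theorem rotate_tuple (hc : LabelsInjective c) (y : J) (n : ℕ) (q q' : Fin 3) (l : ZMod (n + 1))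
    (h : (Base.pt q).rot = Base.pt q') :
    rotate n ∘ tuple c y n q l = tuple c y n q' (l + (Base.pt q).carry) := by
  funext j
  by_cases hj : j.down = n
  · simp only [Function.comp_apply, tuple, if_pos hj, rotate_mk hc, rotPos, ofLex_toLex, h]
  · simp only [Function.comp_apply, tuple, if_neg hj]
    refine rotate_of_forall_ne fun l hl => hj ?_
    exact (hc.eq hl).symm

variable [LinearOrder J]

theorem LexSet.Ioo_nonempty_of {P : ℤ → ℤ → Prop} {x y : LexSet P} (q z : ℤ) (h : P q z)
    (h₁ : (ofLex x.1).1 < q ∨ (ofLex x.1).1 = q ∧ (ofLex x.1).2 < z)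
    (h₂ : q < (ofLex y.1).1 ∨ q = (ofLex y.1).1 ∧ z < (ofLex y.1).2) : (Ioo x y).Nonempty :=
  ⟨⟨toLex (q, z), h⟩, LexSet.lt_iff.2 h₁, LexSet.lt_iff.2 h₂⟩

theorem LexSet.exists_eq {P : ℤ → ℤ → Prop} (x : LexSet P) :
    ∃ (q z : ℤ) (h : P q z), x = ⟨toLex (q, z), h⟩ :=
  ⟨(ofLex x.1).1, (ofLex x.1).2, x.2, rfl⟩

theorem OuterBase.Ioo_incl_nonempty_iff (x y : OuterBase) :
    (Ioo x.incl y.incl).Nonempty ↔ (Ioo x y).Nonempty := by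
  constructor
  · rintro ⟨w, hw₁, hw₂⟩
    obtain ⟨q, z, hx, rfl⟩ := x.exists_eq
    obtain ⟨q', z', hy, rfl⟩ := y.exists_eq
    obtain ⟨q'', z'', hw, rfl⟩ := w.exists_eq
    replace hw₁ : q < q'' ∨ q = q'' ∧ z < z'' := LexSet.lt_iff.1 hw₁
    replace hw₂ : q'' < q' ∨ q'' = q' ∧ z'' < z' := LexSet.lt_iff.1 hw₂
    -- The successor of `x` in `Base` already belongs to `OuterBase`, so the inclusion preserves
    -- adjacency.
    exact LexSet.Ioo_nonempty_of q (z + 1) (by lia) (Or.inr ⟨rfl, lt_add_one z⟩)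
      (show q < q' ∨ q = q' ∧ z + 1 < z' by lia)
  · rintro ⟨w, hw₁, hw₂⟩
    exact ⟨w.incl, hw₁, hw₂⟩

theorem OuterBase.Iio_incl_nonempty_iff (x : OuterBase) :
    (Iio x.incl).Nonempty ↔ (Iio x).Nonempty := by
  constructor
  · rintro ⟨w, hw⟩
    obtain ⟨q, z, hx, rfl⟩ := x.exists_eq
    obtain ⟨q', z', hw', rfl⟩ := w.exists_eq
    replace hw : q' < q ∨ q' = q ∧ z' < z := LexSet.lt_iff.1 hw
    exact ⟨⟨toLex (0, 0), Or.inl (by decide)⟩, LexSet.lt_iff.2 (show 0 < q ∨ 0 = q ∧ 0 < z by lia)⟩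
  · rintro ⟨w, hw⟩
    exact ⟨w.incl, hw⟩

theorem OuterBase.Ioi_incl_nonempty_iff (x : OuterBase) :
    (Ioi x.incl).Nonempty ↔ (Ioi x).Nonempty := by
  constructor
  · rintro ⟨w, hw⟩
    obtain ⟨q, z, hx, rfl⟩ := x.exists_eq
    obtain ⟨q', z', hw', rfl⟩ := w.exists_eq
    replace hw : q < q' ∨ q = q' ∧ z < z' := LexSet.lt_iff.1 hw
    exact ⟨⟨toLex (3, -1), Or.inr (by decide)⟩, LexSet.lt_iff.2 (show q < 3 ∨ q = 3 ∧ z < -1 by lia)⟩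
  · rintro ⟨w, hw⟩
    exact ⟨w.incl, hw⟩

/-- The inclusion of circles over `OuterBase` in circles over `Base` is elementary. -/
def outerEmbedding (hJ : IsIdempotentOrder J) (c : (n : ℕ) → ZMod (n + 1) → Λ) :
    Circles (OuterBase ×ₗ J) c ↪ₑ[circleLang.{u}] Circles (Base ×ₗ J) c where
  toFun x := ⟨toLex ((ofLex x.pos).1.incl, (ofLex x.pos).2), x.label⟩
  map_formula' k φ x := by
    refine realize_iff_of_forall_sim φ (fun _ => rfl) fun F m => ?_
    exact sim_lex hJ isDiscreteWithEndpoints_base isDiscreteWithEndpoints_outerBase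
      (fun i => (ofLex (x i).pos).1.incl) (fun i => (ofLex (x i).pos).1)
      (fun i => (ofLex (x i).pos).2) (fun i _ j _ => Iff.rfl)
      (fun i _ j _ => OuterBase.Ioo_incl_nonempty_iff _ _)
      (fun i _ => OuterBase.Iio_incl_nonempty_iff _)
      (fun i _ => OuterBase.Ioi_incl_nonempty_iff _) m

/-- The points `Base.pt 1` and `Base.pt 2` lie in the inner copies of `ζ`. They realize the same cut
of `OuterBase` and are adjacent to none of its points, so `sim_lex` cannot tell them apart. -/
theorem realize_tuple_iff (hJ : IsIdempotentOrder J) (y : J) (n : ℕ) (l : ZMod (n + 1))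
    (φ : circleLang.{u}.Formula (Circles (OuterBase ×ₗ J) c ⊕ ULift.{u} ℕ)) :
    φ.Realize (Sum.elim (outerEmbedding hJ c) (tuple c y n 1 l)) ↔
      φ.Realize (Sum.elim (outerEmbedding hJ c) (tuple c y n 2 l)) := by
  have hlabel (k) : (Sum.elim (outerEmbedding hJ c) (tuple c y n 1 l) k).label =
      (Sum.elim (outerEmbedding hJ c) (tuple c y n 2 l) k).label := by
    rcases k with k | k
    · rfl
    · simp only [Sum.elim_inr, tuple]
      split_ifs <;> rfl
  refine realize_iff_of_forall_sim φ hlabel fun F m => ?_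
  let s (q : Fin 3) (k : Circles (OuterBase ×ₗ J) c ⊕ ULift.{u} ℕ) : Base :=
    (ofLex (Sum.elim (outerEmbedding hJ c) (tuple c y n q l) k).pos).1
  let x (k : Circles (OuterBase ×ₗ J) c ⊕ ULift.{u} ℕ) : J :=
    Sum.elim (fun a => (ofLex a.pos).2) (fun _ => y) k
  have hx (q : Fin 3) (k) : (Sum.elim (outerEmbedding hJ c) (tuple c y n q l) k).pos =
      toLex (s q k, x k) := by
    rcases k with k | k
    · rfl
    · simp only [s, x, Sum.elim_inr, tuple]
      split_ifs <;> rfl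
  -- Only the entry of index `n` moves. The parameters and the other entries, which are over
  -- `Base.pt 0`, stay in the outer part.
  have hs (k) : s 1 k = s 2 k ∧ ((ofLex (s 1 k).1).1 = 0 ∨ (ofLex (s 1 k).1).1 = 3) ∨
      s 1 k = Base.pt 1 ∧ s 2 k = Base.pt 2 := by
    rcases k with k | k
    · refine Or.inl ⟨rfl, ?_⟩
      have := (ofLex k.pos).1.2
      exact this.imp And.left And.left
    · simp only [s, Sum.elim_inr, tuple]
      split_ifs
      · exact Or.inr ⟨rfl, rfl⟩
      · exact Or.inl ⟨rfl, Or.inl rfl⟩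
  have p₁ : (ofLex (Base.pt 1).1).1 = 1 ∧ (ofLex (Base.pt 1).1).2 = 0 := ⟨rfl, rfl⟩
  have p₂ : (ofLex (Base.pt 2).1).1 = 2 ∧ (ofLex (Base.pt 2).1).2 = 0 := ⟨rfl, rfl⟩
  simp only [hx]
  refine sim_lex hJ isDiscreteWithEndpoints_base isDiscreteWithEndpoints_base _ _ _
    (fun i _ j _ => ?_) (fun i _ j _ => ?_) (fun i _ => ?_) (fun i _ => ?_) m
  · rw [LexSet.lt_iff, LexSet.lt_iff]
    have hi' := (s 1 i).2
    have hj' := (s 1 j).2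
    rcases hs i with ⟨e, hi⟩ | ⟨hi, e⟩ <;> rcases hs j with ⟨e', hj⟩ | ⟨hj, e'⟩ <;>
      simp only [← e, ← e', hi, hj, p₁] <;> lia
  · have mid {k k'} (hk : (ofLex (s 1 k).1).1 = 0 ∨ (ofLex (s 1 k).1).1 = 3)
        (h : s 1 k = s 2 k) (hk'₁ : s 1 k' = Base.pt 1) (hk'₂ : s 2 k' = Base.pt 2) :
        ((Ioo (s 1 k) (s 1 k')).Nonempty ↔ (Ioo (s 2 k) (s 2 k')).Nonempty) ∧
        ((Ioo (s 1 k') (s 1 k)).Nonempty ↔ (Ioo (s 2 k') (s 2 k)).Nonempty) := by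
      have hk' := (s 1 k).2
      rw [← h, hk'₁, hk'₂]
      rcases hk with hk | hk
      · refine ⟨iff_of_true ?_ ?_, iff_of_false ?_ ?_⟩
        · exact LexSet.Ioo_nonempty_of 0 ((ofLex (s 1 k).1).2 + 1) (by lia) (by lia) (by lia)
        · exact LexSet.Ioo_nonempty_of 0 ((ofLex (s 1 k).1).2 + 1) (by lia) (by lia) (by lia)
        · rintro ⟨w, hw₁, hw₂⟩
          have := LexSet.lt_iff.1 (hw₁.trans hw₂)
          lia
        · rintro ⟨w, hw₁, hw₂⟩
          have := LexSet.lt_iff.1 (hw₁.trans hw₂)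
          lia
      · refine ⟨iff_of_false ?_ ?_, iff_of_true ?_ ?_⟩
        · rintro ⟨w, hw₁, hw₂⟩
          have := LexSet.lt_iff.1 (hw₁.trans hw₂)
          lia
        · rintro ⟨w, hw₁, hw₂⟩
          have := LexSet.lt_iff.1 (hw₁.trans hw₂)
          lia
        · exact LexSet.Ioo_nonempty_of 3 ((ofLex (s 1 k).1).2 - 1) (by lia) (by lia) (by lia)
        · exact LexSet.Ioo_nonempty_of 3 ((ofLex (s 1 k).1).2 - 1) (by lia) (by lia) (by lia)
    rcases hs i with ⟨e, hi⟩ | ⟨hi, e⟩ <;> rcases hs j with ⟨e', hj⟩ | ⟨hj, e'⟩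
    · rw [e, e']
    · exact (mid hi e hj e').1
    · exact (mid hj e' hi e).2
    · rw [hi, hj, e, e']
      simp
  · rcases hs i with ⟨e, hi⟩ | ⟨hi, e⟩
    · rw [e]
    · rw [hi, e]
      exact iff_of_true ⟨Base.pt 0, LexSet.lt_iff.2 (Or.inl (by decide))⟩
        ⟨Base.pt 0, LexSet.lt_iff.2 (Or.inl (by decide))⟩
  · rcases hs i with ⟨e, hi⟩ | ⟨hi, e⟩
    · rw [e]
    · rw [hi, e]
      exact iff_of_true ⟨⟨toLex (3, -1), by simp [InBase]⟩, LexSet.lt_iff.2 (Or.inl (by decide))⟩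
        ⟨⟨toLex (3, -1), by simp [InBase]⟩, LexSet.lt_iff.2 (Or.inl (by decide))⟩

/-- The points with labels `0` and `k` of the `n`-th circle have Lascar distance at most `3 k`. -/
theorem lascarDistLE_tuple (hJ : IsIdempotentOrder J) (hc : LabelsInjective c) (y : J) (n k : ℕ) :
    LascarDistLE circleLang.{u} (3 * k) (tuple c y n 0 0) (tuple c y n 0 (k : ZMod (n + 1))) := by
  let σ := rotateEquiv (J := J) hc n
  let a := tuple c y n 0 0
  have s₁ : rotate n ∘ a = tuple c y n 1 0 := by
    rw [rotate_tuple hc y n 0 1 0 Base.rot_pt_zero.1, Base.rot_pt_zero.2, Nat.cast_zero, add_zero]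
  have s₂ : rotate n ∘ tuple c y n 1 0 = tuple c y n 2 0 := by
    rw [rotate_tuple hc y n 1 2 0 Base.rot_pt_one.1, Base.rot_pt_one.2, Nat.cast_zero, add_zero]
  -- `τ p` is the rotation to the power `p - 1`, with the inverse rotation for `p = 0`. The known
  -- pair of tuples with equal types is over `Base.pt 1` and `Base.pt 2`, one rotation after `a`,
  -- and the `p`-th step of the chain is its image under `τ p`.
  let τ (p : ℕ) : Circles (Base ×ₗ J) c ≃[circleLang.{u}] Circles (Base ×ₗ J) c :=
    Nat.rec σ.symm (fun _ t => t.comp σ) p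
  have hτ (p : ℕ) : ∀ x, τ p (rotate n x) = (rotate n)^[p] x := by
    induction p with
    | zero => exact fun x => σ.symm_apply_apply x
    | succ p ih =>
      intro x
      rw [Function.iterate_succ_apply, ← ih]
      rfl
  refine ⟨fun p => (rotate n)^[p] ∘ a, rfl, ?_, fun p _ => ?_⟩
  · induction k with
    | zero => simp [a]
    | succ k ih =>
      change (rotate n)^[3 * k] ∘ a = _ at ih
      change (rotate n)^[3 * (k + 1)] ∘ a = _
      rw [show 3 * (k + 1) = 3 + 3 * k by ring, Function.iterate_add, Function.comp_assoc, ih]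
      change rotate n ∘ rotate n ∘ rotate n ∘ _ = _
      rw [rotate_tuple hc y n 0 1 _ Base.rot_pt_zero.1, rotate_tuple hc y n 1 2 _ Base.rot_pt_one.1,
        rotate_tuple hc y n 2 0 _ Base.rot_pt_two.1, Base.rot_pt_zero.2, Base.rot_pt_one.2,
        Base.rot_pt_two.2]
      simp
  · refine ⟨elementaryRange ((τ p).toElementaryEmbedding.comp (outerEmbedding hJ c)), ?_⟩
    rw [coe_elementaryRange]
    refine eqTypeOver_range _ fun φ => ?_
    have e₁ : Sum.elim ((τ p).toElementaryEmbedding.comp (outerEmbedding hJ c))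
        ((rotate n)^[p] ∘ a) = (τ p).toElementaryEmbedding ∘
          Sum.elim (outerEmbedding hJ c) (tuple c y n 1 0) := by
      funext x
      rcases x with x | x
      · rfl
      · rw [← s₁]
        exact (hτ p _).symm
    have e₂ : Sum.elim ((τ p).toElementaryEmbedding.comp (outerEmbedding hJ c))
        ((rotate n)^[p + 1] ∘ a) = (τ p).toElementaryEmbedding ∘
          Sum.elim (outerEmbedding hJ c) (tuple c y n 2 0) := by
      funext x
      rcases x with x | x
      · rfl
      · rw [← s₂, ← s₁]
        exact (hτ p _).symm
    rw [e₁, e₂, (τ p).toElementaryEmbedding.map_formula, (τ p).toElementaryEmbedding.map_formula]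
    exact realize_tuple_iff hJ y n 0 φ

end LascarChain

end CircleStructure

/-! ### Lower bounds on Lascar distance and the failure of G-compactness. -/

namespace CircleStructure

open Set FirstOrder.Language EhrenfeuchtFraisse LascarDistance Cardinal

section Linked

variable {M M' : Type u} [circleLang.{u}.Structure M] [circleLang.{u}.Structure M']

/-- There are `d + 1` points from `x` to `y` such that any two consecutive ones lie on a common arc
of the `n`-th circle. -/
def Linked (n : ℕ) (x : M) : ℕ → M → Prop
  | 0, y => x = y
  | d + 1, y => ∃ w : Fin 2 → M, Linked n x d (w 0) ∧
      Structure.RelMap (arc.{u} n) ![w 1, w 0] ∧ Structure.RelMap (arc.{u} n) ![w 1, y]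

/-- A formula that expresses `Linked`. -/
noncomputable def linkedFormula (n : ℕ) : ℕ → circleLang.{u}.Formula (Fin 2)
  | 0 => (Term.var 0).equal (Term.var 1)
  | d + 1 => Formula.iExs (Fin 2)
      ((linkedFormula n d).relabel (![Sum.inl 0, Sum.inr 0] : Fin 2 → Fin 2 ⊕ Fin 2) ⊓
        ((arc n).formula₂ (Term.var (Sum.inr 1)) (Term.var (Sum.inr 0)) ⊓
          (arc n).formula₂ (Term.var (Sum.inr 1)) (Term.var (Sum.inl 1))))

theorem realize_linkedFormula {n d : ℕ} {v : Fin 2 → M} :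
    (linkedFormula.{u} n d).Realize v ↔ Linked n (v 0) d (v 1) := by
  induction d generalizing v with
  | zero => simp [linkedFormula, Linked, Formula.realize_equal]
  | succ d ih =>
    simp [linkedFormula, Linked, Formula.realize_relabel, ih, Formula.realize_iExs,
      Formula.realize_rel₂]

theorem linked_map_iff (e : M ↪ₑ[circleLang.{u}] M') {n d : ℕ} {x y : M} :
    Linked n (e x) d (e y) ↔ Linked n x d y := by
  have := e.map_formula (linkedFormula.{u} n d) ![x, y]
  rwa [realize_linkedFormula, realize_linkedFormula] at this

/-- A formula that expresses that every point of the `n`-th circle lies on one of `n + 1` arcs. -/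
noncomputable def coverFormula (n : ℕ) : circleLang.{u}.Formula (Empty ⊕ ZMod (n + 1)) :=
  Formula.iAlls (Fin 2)
    (((arc n).formula₂ (Term.var (Sum.inr 0)) (Term.var (Sum.inr 1))).imp
      (Formula.iSup fun i : ZMod (n + 1) =>
        (arc n).formula₂ (Term.var (Sum.inl (Sum.inr i))) (Term.var (Sum.inr 1))))

theorem realize_coverFormula {n : ℕ} {v : Empty ⊕ ZMod (n + 1) → M} :
    (coverFormula.{u} n).Realize v ↔ ∀ w : Fin 2 → M, Structure.RelMap (arc.{u} n) ![w 0, w 1] →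
      ∃ i, Structure.RelMap (arc.{u} n) ![v (Sum.inr i), w 1] := by
  simp [coverFormula, Formula.realize_iAlls, Formula.realize_rel₂, Formula.realize_iSup]

/-- A sentence that expresses that the `n`-th circle is covered by `n + 1` arcs. -/
noncomputable def coverSentence (n : ℕ) : circleLang.{u}.Sentence :=
  Formula.iExs (ZMod (n + 1)) (coverFormula n)

theorem realize_coverSentence {n : ℕ} :
    M ⊨ coverSentence.{u} n ↔ ∃ m : ZMod (n + 1) → M, ∀ w : Fin 2 → M,
      Structure.RelMap (arc.{u} n) ![w 0, w 1] → ∃ i, Structure.RelMap (arc.{u} n) ![m i, w 1] := by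
  simp only [coverSentence, Sentence.Realize, Formula.realize_iExs, realize_coverFormula,
    Sum.elim_inr]

/-- An elementary submodel contains points whose `n + 1` arcs cover the `n`-th circle of `M`. A
point of the circle lies on one of these arcs, and any point with the same type over the submodel
lies on the same one. -/
theorem linked_of_lascarDistLE {n d : ℕ} (hM : M ⊨ coverSentence.{u} n) {K : Type u} {a b : K → M}
    (h : LascarDistLE circleLang.{u} d a b) {k : K} {w : M}
    (hw : Structure.RelMap (arc.{u} n) ![w, a k]) : Linked n (a k) d (b k) := by
  obtain ⟨f, rfl, rfl, hf⟩ := h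
  -- The second clause keeps track that the chain stays on the `n`-th circle, which the covering
  -- needs.
  suffices ∀ i ≤ d, Linked n (f 0 k) i (f i k) ∧
      ∃ w, Structure.RelMap (arc.{u} n) ![w, f i k] from (this d le_rfl).1
  intro i
  induction i with
  | zero => exact fun _ => ⟨rfl, w, hw⟩
  | succ i ih =>
    intro hi
    obtain ⟨hl, w, hw⟩ := ih (by lia)
    obtain ⟨S, hS⟩ := hf i (by lia)
    have hS' : S ⊨ coverSentence.{u} n := (S.realize_sentence _).2 hM
    obtain ⟨m, hm⟩ := Formula.realize_iExs.1 hS'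
    have := realize_coverFormula.1 ((S.subtype.map_formula _ _).2 hm) ![w, f i k] hw
    obtain ⟨j, hj⟩ := this
    have := (hS ((arc.{u} n).formula₂ (Term.var (Sum.inl (m j))) (Term.var (Sum.inr k)))).1
      (Formula.realize_rel₂.2 hj)
    have hj' := Formula.realize_rel₂.1 this
    exact ⟨⟨![f i k, m j], hl, hj, hj'⟩, m j, hj'⟩

end Linked

section Circles

variable {α β J Λ : Type u} [LinearOrder α] [LinearOrder β] {c : (n : ℕ) → ZMod (n + 1) → Λ}

theorem coverSentence_realize (hc : LabelsInjective c) [Nonempty α] (n : ℕ) :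
    Circles α c ⊨ coverSentence.{u} n := by
  let p : α := Classical.arbitrary α
  refine realize_coverSentence.2 ⟨fun i => ⟨p, c n i⟩, fun w hw => ?_⟩
  obtain ⟨i, j, -, h, -⟩ := relMap_arc.1 hw
  simp only [relMap_arc, Matrix.cons_val_zero, Matrix.cons_val_one] at h ⊢
  rcases w1 : w 1 with ⟨q, l⟩
  rw [w1] at h
  cases h
  rcases le_or_gt p q with h | h
  · exact ⟨j, (isArc_mk hc).2 (Or.inl ⟨rfl, h⟩)⟩
  · exact ⟨j - 1, (isArc_mk hc).2 (Or.inr ⟨by simp, h⟩)⟩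

/-- An arc meets only the label of its starting point and the next one, so each link changes the
label by at most one. -/
theorem Linked.label (hc : LabelsInjective c) {n d : ℕ} {x y : Circles α c} (h : Linked n x d y)
    {i : ZMod (n + 1)} (hx : x.label = c n i) :
    ∃ k : ℤ, |k| ≤ d ∧ y.label = c n (i + k) := by
  induction d generalizing y with
  | zero => exact ⟨0, by simp, by cases h; simpa using hx⟩
  | succ d ih =>
    obtain ⟨w, h, h₁, h₂⟩ := h
    obtain ⟨k, hk, hl⟩ := ih h
    obtain ⟨j, j', e, e', h₁⟩ := relMap_arc.1 h₁
    obtain ⟨l, l', f, f', h₂⟩ := relMap_arc.1 h₂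
    simp only [Matrix.cons_val_zero, Matrix.cons_val_one] at e e' f f'
    have hjl := hc.injective n (e.symm.trans f)
    have hj' := hc.injective n (e'.symm.trans hl)
    rw [abs_le] at hk
    rcases h₁ with ⟨h₁, -⟩ | ⟨h₁, -⟩ <;> rcases h₂ with ⟨h₂, -⟩ | ⟨h₂, -⟩
    · exact ⟨k, abs_le.2 ⟨by lia, by lia⟩, by rw [f', ← h₂, ← hjl, h₁, hj']⟩
    · exact ⟨k + 1, abs_le.2 ⟨by lia, by lia⟩, by
        rw [f', h₂, ← hjl, h₁, hj', Int.cast_add, Int.cast_one, add_assoc]⟩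
    · refine ⟨k - 1, abs_le.2 ⟨by lia, by lia⟩, ?_⟩
      rw [f', ← h₂, ← hjl, Int.cast_sub, Int.cast_one, ← add_sub_assoc, ← hj', h₁]
      simp
    · exact ⟨k, abs_le.2 ⟨by lia, by lia⟩, by rw [f', h₂, ← hjl, ← h₁, hj']⟩

/-- The circle has `2 d + 2` labels, so `d + 1` is opposite to `0` and is not reached by `d` steps
in either direction. -/
theorem not_linked (hc : LabelsInjective c) (d : ℕ) (p q : α) :
    ¬ Linked (2 * d + 1) (⟨p, c (2 * d + 1) 0⟩ : Circles α c) d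
      ⟨q, c (2 * d + 1) ((d + 1 : ℕ) : ZMod (2 * d + 1 + 1))⟩ := by
  intro h
  obtain ⟨k, hk, e⟩ := h.label hc rfl
  have e := hc.injective _ e
  rw [zero_add, ← Int.cast_natCast, ZMod.intCast_eq_intCast_iff_dvd_sub] at e
  rw [abs_le] at hk
  obtain ⟨r, hr⟩ := e
  push_cast at hr
  have h₁ : (2 * (d : ℤ) + 1 + 1) * r < 0 := by lia
  have h₂ : -(2 * (d : ℤ) + 1 + 1) < (2 * (d : ℤ) + 1 + 1) * r := by lia
  have h₃ : r < 0 := by nlinarith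
  nlinarith

variable [LinearOrder J]

/-- For empty tuples, similarity only compares the types of the whole orders, and `efType_block`
applies. The symmetric model thereby shares the theory of the interpreted one. -/
theorem realize_sentence_base_iff (hJ : IsIdempotentOrder J) (φ : circleLang.{u}.Sentence) :
    Circles (Base ×ₗ J) c ⊨ φ ↔ Circles J c ⊨ φ := by
  refine realize_iff_of_forall_sim φ (fun k => k.elim) fun F m => ⟨fun i => i.elim, ?_⟩
  intro o o' _ _
  cases o with
  | some k => exact k.elim
  | none =>
    cases o' with
    | some k => exact k.elim
    | none =>
      have := efType_block hJ m isDiscreteWithEndpoints_base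
      convert this using 2 <;> · ext; simp [gap, block]

theorem card_circleLang_le : circleLang.{u}.card ≤ ℵ₀ := by
  have : Countable (Σ n, circleLang.{u}.Relations n) := by
    refine (Function.Surjective.countable (f := fun n : ℕ => (⟨2, arc n⟩ :
      Σ n, circleLang.{u}.Relations n)) ?_)
    rintro ⟨_, ⟨n⟩⟩
    exact ⟨n, rfl⟩
  have : IsEmpty (Σ n, circleLang.{u}.Functions n) := ⟨fun x => PEmpty.elim x.2⟩
  exact mk_le_aleph0

/-- The complete theory of a union of circles over an idempotent order is not G-compact. -/
theorem not_isGCompact (hJ : IsIdempotentOrder J) (hc : LabelsInjective c) [Nonempty J] :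
    ¬ IsGCompact (circleLang.{u}.completeTheory (Circles J c)) := by
  rintro ⟨κ, C, _, _, hC, hκ, h⟩
  let y : J := Classical.arbitrary J
  -- The starting tuple does not depend on `n`, so a single tuple begins all the chains.
  have hbase (n : ℕ) : tuple c y n 0 0 = fun j => ⟨toLex (Base.pt 0, y), c j.down 0⟩ := by
    funext j
    simp only [tuple]
    split_ifs with hj
    · subst hj; rfl
    · rfl
  -- The `d`-th chain leads to the point opposite to label `0` in the circle with `2 d + 2` labels.
  have hchain (d : ℕ) := lascarDistLE_tuple hJ hc y (2 * d + 1) (d + 1)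
  simp only [hbase] at hchain
  -- The monster model is only known to embed countable models, so all chains are first collected in
  -- a countable one.
  obtain ⟨N, a, b, _, ha, hb, hd⟩ := exists_countable_lascarDistLE card_circleLang_le hchain
  have hsen (φ : circleLang.{u}.Sentence) : N ⊨ φ ↔ C ⊨ φ := by
    rw [N.realize_sentence, realize_sentence_base_iff hJ]
    exact ((realize_iff_of_model_completeTheory (Circles J c) C φ)).symm
  have : Nonempty N := ⟨a ⟨0⟩⟩
  obtain ⟨e⟩ := exists_elementaryEmbedding hκ.aleph0_lt hκ.saturated hsen
  obtain ⟨d, hd'⟩ := h (ULift.{u} ℕ) ((mk_le_aleph0).trans_lt hκ.aleph0_lt) (e ∘ a)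
  have : Nonempty (Base ×ₗ J) := ⟨toLex (Base.pt 0, y)⟩
  have hcov : C ⊨ coverSentence.{u} (2 * d + 1) := by
    rw [← hsen, N.realize_sentence]
    exact coverSentence_realize hc _
  have hlas := hd' (e ∘ b d) ⟨_, LascarDistLE.map (hd d) e⟩
  have hself : Structure.RelMap (arc.{u} (2 * d + 1))
      ![(e ∘ a) ⟨2 * d + 1⟩, (e ∘ a) ⟨2 * d + 1⟩] := by
    have h₁ : IsArc (2 * d + 1) (a ⟨2 * d + 1⟩ : Circles (Base ×ₗ J) c) (a ⟨2 * d + 1⟩) := by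
      rw [ha]
      exact (isArc_mk hc).2 (Or.inl ⟨rfl, le_rfl⟩)
    have h₂ : Structure.RelMap (arc.{u} (2 * d + 1)) ![a ⟨2 * d + 1⟩, a ⟨2 * d + 1⟩] := by
      rw [← N.subtype.map_rel]
      exact h₁
    rw [← e.map_rel] at h₂
    convert h₂ using 1
    funext i
    fin_cases i <;> rfl
  have hlink := linked_of_lascarDistLE hcov hlas hself
  rw [Function.comp_apply, Function.comp_apply, linked_map_iff, ← linked_map_iff N.subtype] at hlink
  refine not_linked hc d (toLex (Base.pt 0, y)) (toLex (Base.pt 0, y)) ?_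
  convert hlink using 1
  · exact (ha _).symm
  · refine Eq.trans ?_ (hb _ _).symm
    simp [tuple]

end Circles

end CircleStructure

/-! ### Interpreted linear orders and their ultrapowers. -/

namespace OrderInterpretation

open Set Filter FirstOrder.Language EhrenfeuchtFraisse CircleStructure

section

variable {L : FirstOrder.Language.{u, u}} {M K : Type u} [L.Structure M] [LinearOrder K]

/-- Substituting parameters for variables preserves definability with parameters. -/
theorem definable_preimage_const {ι ι' : Type*} {s : Set (ι' → M)}
    (hs : (univ : Set M).Definable L s) (h : ι' → M ⊕ ι) :
    (univ : Set M).Definable L {v : ι → M | Sum.elim id v ∘ h ∈ s} := by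
  rw [definable_iff_exists_formula_sum] at hs ⊢
  obtain ⟨φ, rfl⟩ := hs
  refine ⟨φ.relabel (Sum.elim Sum.inl
    fun i => (h i).map (fun m => (⟨m, mem_univ m⟩ : (univ : Set M))) id), ?_⟩
  ext v
  simp only [mem_ofPred_eq, Formula.realize_relabel]
  refine iff_of_eq (congrArg _ ?_)
  funext i
  rcases i with i | i
  · rfl
  · simp only [Function.comp_apply, Sum.elim_inr]
    cases h i <;> rfl

/-- A surjection from `X ⊆ Mⁿ` to the order `K` such that the preimage of the order is definable,
given as a map on all of `Mⁿ`. -/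
structure OrderCoordinates (L : FirstOrder.Language.{u, u}) (M : Type u) [L.Structure M]
    (K : Type u) [LinearOrder K] (n : ℕ) where
  /-- The domain of the surjection. -/
  dom : Set (Fin n → M)
  /-- An extension of the surjection. -/
  val : (Fin n → M) → K
  surj : ∀ y, ∃ x ∈ dom, val x = y
  definable : (univ : Set M).Definable L {v : Fin n ⊕ Fin n → M |
    v ∘ Sum.inl ∈ dom ∧ v ∘ Sum.inr ∈ dom ∧ val (v ∘ Sum.inl) ≤ val (v ∘ Sum.inr)}

theorem exists_orderCoordinates [Nonempty K]
    (h : letI : FirstOrder.Language.order.Structure K := FirstOrder.Language.orderStructure K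
      Interprets L M FirstOrder.Language.order K) :
    ∃ n, Nonempty (OrderCoordinates L M K n) := by
  classical
  let _ : FirstOrder.Language.order.Structure K := FirstOrder.Language.orderStructure K
  obtain ⟨n, X, f, hf, -, -, hR, -⟩ := h
  refine ⟨n, ⟨X, fun v => if h : v ∈ X then f ⟨v, h⟩ else Classical.arbitrary K, fun y => ?_, ?_⟩⟩
  · obtain ⟨x, rfl⟩ := hf y
    exact ⟨x, x.2, dif_pos x.2⟩
  · have := (hR 2 leSymb).preimage_comp
      (fun p : Fin 2 × Fin n => (![Sum.inl p.2, Sum.inr p.2] : Fin 2 → Fin n ⊕ Fin n) p.1)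
    convert this using 1
    ext v
    constructor
    · rintro ⟨h₁, h₂, h⟩
      rw [dif_pos h₁, dif_pos h₂] at h
      refine ⟨![⟨_, h₁⟩, ⟨_, h₂⟩], ?_, h⟩
      intro i j
      fin_cases i <;> rfl
    · rintro ⟨x, hx, h⟩
      have e₁ : v ∘ Sum.inl = x 0 := funext fun j => hx 0 j
      have e₂ : v ∘ Sum.inr = x 1 := funext fun j => hx 1 j
      have h₁ : v ∘ Sum.inl ∈ X := e₁ ▸ (x 0).2
      have h₂ : v ∘ Sum.inr ∈ X := e₂ ▸ (x 1).2
      refine ⟨h₁, h₂, ?_⟩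
      rw [dif_pos h₁, dif_pos h₂, show (⟨_, h₁⟩ : X) = x 0 from Subtype.ext e₁,
        show (⟨_, h₂⟩ : X) = x 1 from Subtype.ext e₂]
      exact h

/-- Orders interpreted in a structure have ultrapowers interpreted in the ultrapower. -/
theorem OrderCoordinates.ultrapower [Nonempty M] {n : ℕ} (C : OrderCoordinates L M K n)
    (U : Ultrafilter ℕ) :
    Nonempty (OrderCoordinates L ((U : Filter ℕ).Product fun _ => M) ((U : Filter ℕ).Germ K) n) := by
  obtain ⟨φ, hφ⟩ := definable_iff_exists_formula_sum.1 C.definable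
  have hφ' (v : Fin n ⊕ Fin n → M) := Set.ext_iff.1 hφ v
  let r (x : (U : Filter ℕ).Product fun _ => M) : ℕ → M := Quotient.out x
  have hr (x) : ((r x : ℕ → M) : (U : Filter ℕ).Product fun _ => M) = x := Quotient.out_eq x
  let row (v : Fin n → (U : Filter ℕ).Product fun _ => M) (t : ℕ) : Fin n → M := fun i => r (v i) t
  refine ⟨⟨{v | ∀ᶠ t in U, row v t ∈ C.dom}, fun v => ((fun t => C.val (row v t) : ℕ → K) :),
    fun y => ?_, ?_⟩⟩
  · induction y using Germ.inductionOn with | _ y =>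
    choose x hx hxy using fun t => C.surj (y t)
    let v (i : Fin n) : (U : Filter ℕ).Product fun _ => M := ((fun t => x t i : ℕ → M) :)
    have hv : ∀ᶠ t in U, row v t = x t := by
      have : ∀ i, ∀ᶠ t in U, r (v i) t = x t i := fun i =>
        Quotient.exact (hr (v i))
      filter_upwards [eventually_all.2 this] with t ht
      exact funext ht
    refine ⟨v, ?_, Germ.coe_eq.2 ?_⟩
    · filter_upwards [hv] with t ht
      rw [ht]; exact hx t
    · filter_upwards [hv] with t ht
      rw [ht]; exact hxy t
  -- The same formula defines the order, with each parameter replaced by its constant sequence. This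
  -- is Łoś's theorem.
  · refine definable_iff_exists_formula_sum.2 ⟨φ.relabel (Sum.map
      (fun m : (univ : Set M) => (⟨((fun _ => m.1 : ℕ → M) :), mem_univ _⟩ :
        (univ : Set ((U : Filter ℕ).Product fun _ => M)))) id), ?_⟩
    ext v
    have key : (φ.relabel (Sum.map
      (fun m : (univ : Set M) => (⟨((fun _ => m.1 : ℕ → M) :), mem_univ _⟩ :
        (univ : Set ((U : Filter ℕ).Product fun _ => M)))) id)).Realize (Sum.elim (↑) v) ↔
        ∀ᶠ t in U, φ.Realize (Sum.elim (fun m : (univ : Set M) => (m : M)) fun i => r (v i) t) := by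
      have := Ultraproduct.realize_formula_cast (M := fun _ : ℕ => M) (u := U) φ
        (Sum.elim (fun m _ => m) fun i => r (v i))
      rw [Formula.realize_relabel]
      have e : Sum.elim (fun m : (univ : Set ((U : Filter ℕ).Product fun _ => M)) =>
          (m : (U : Filter ℕ).Product fun _ => M)) v ∘ Sum.map
          (fun m : (univ : Set M) => (⟨((fun _ => m.1 : ℕ → M) :), mem_univ _⟩ :
            (univ : Set ((U : Filter ℕ).Product fun _ => M)))) id =
          fun i => ((Sum.elim (fun (m : (univ : Set M)) _ => m.1) (fun i => r (v i)) i : ℕ → M) :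
            (U : Filter ℕ).Product fun _ => M) := by
        funext i
        rcases i with i | i
        · rfl
        · exact (hr (v i)).symm
      rw [e]
      refine this.trans (eventually_congr (Eventually.of_forall fun t => iff_of_eq ?_))
      congr 1
      funext i
      rcases i with i | i <;> rfl
    simp only [mem_ofPred_eq, key, Germ.coe_le]
    rw [EventuallyLE, ← eventually_and, ← eventually_and]
    refine eventually_congr (Eventually.of_forall fun t => hφ' fun i => r (v i) t)

end

end OrderInterpretation

/-! ### Interpretation of the circles in a linear order. -/

namespace OrderInterpretation

open Set Filter FirstOrder.Language EhrenfeuchtFraisse CircleStructure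

section

variable {L : FirstOrder.Language.{u, u}} {M K : Type u} [L.Structure M] [LinearOrder K] {n : ℕ}

/-- The tuples `v` such that the tuples with the entries `p` and `q`, each of which is a parameter
or an entry of `v`, stand for ordered points. -/
def OrderCoordinates.leSet (C : OrderCoordinates L M K n) {ι : Type*} (p q : Fin n → M ⊕ ι) :
    Set (ι → M) :=
  {v | Sum.elim id v ∘ p ∈ C.dom ∧ Sum.elim id v ∘ q ∈ C.dom ∧
    C.val (Sum.elim id v ∘ p) ≤ C.val (Sum.elim id v ∘ q)}

theorem OrderCoordinates.definable_leSet (C : OrderCoordinates L M K n) {ι : Type*}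
    (p q : Fin n → M ⊕ ι) : (univ : Set M).Definable L (C.leSet p q) :=
  definable_preimage_const C.definable (Sum.elim p q)

/-- A relation is interpreted in a definable way if it is definable on the domain. -/
theorem definable_pullback {N : Type u} {d k : ℕ} {X : Set (Fin d → M)}
    (hX : (univ : Set M).Definable L X) (f : X → N) {P : Set (Fin k → N)}
    {Q : Set (Fin k × Fin d → M)} (hQ : (univ : Set M).Definable L Q)
    (h : ∀ x : Fin k → X, (fun p => (x p.1 : Fin d → M) p.2) ∈ Q ↔ (fun i => f (x i)) ∈ P) :
    (univ : Set M).Definable L (pullback f P) := by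
  have hD : (univ : Set M).Definable L (⋂ i : Fin k, {v : Fin k × Fin d → M | v ∘ (i, ·) ∈ X}) :=
    definable_iInter_of_finite fun i => hX.preimage_comp (i, ·)
  convert hD.inter hQ using 1
  ext v
  constructor
  · rintro ⟨x, hx, hP⟩
    have e : v = fun p => (x p.1 : Fin d → M) p.2 := funext fun p => hx p.1 p.2
    refine ⟨mem_iInter.2 fun i => ?_, ?_⟩
    · rw [e]
      exact (x i).2
    · rw [e]
      exact (h x).2 hP
  · rintro ⟨hv, hQ⟩
    exact ⟨fun i => ⟨_, mem_iInter.1 hv i⟩, fun _ _ => rfl, (h fun i => ⟨_, mem_iInter.1 hv i⟩).1 hQ⟩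

/-- A point is coded by two `n`-tuples, one for its position and one for its label, and the labels
`c m i` serve as parameters. Each relation involves finitely many of them and is thus a finite union
of definable sets. -/
theorem interprets_circles (C : OrderCoordinates L M K n) (a b : K)
    (c : (n : ℕ) → ZMod (n + 1) → K) :
    Interprets L M circleLang.{u} (Circles (Ico a b) c) := by
  obtain ⟨xa, hxa, rfl⟩ := C.surj a
  obtain ⟨xb, hxb, rfl⟩ := C.surj b
  choose z hz hzc using fun (m : ℕ) (i : ZMod (m + 1)) => C.surj (c m i)
  let X : Set (Fin (n + n) → M) := {v | (v ∘ Fin.castAdd n ∈ C.dom ∧ v ∘ Fin.natAdd n ∈ C.dom) ∧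
    C.val xa ≤ C.val (v ∘ Fin.castAdd n) ∧ C.val (v ∘ Fin.castAdd n) < C.val xb}
  let f (v : X) : Circles (Ico (C.val xa) (C.val xb)) c :=
    ⟨⟨C.val (v.1 ∘ Fin.castAdd n), v.2.2⟩, C.val (v.1 ∘ Fin.natAdd n)⟩
  have hX : (univ : Set M).Definable L X := by
    let p (j : Fin n) : M ⊕ Fin (n + n) := Sum.inr (Fin.castAdd n j)
    let q (j : Fin n) : M ⊕ Fin (n + n) := Sum.inr (Fin.natAdd n j)
    -- `C.leSet p p` just says that the tuple `p` belongs to the domain.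
    convert ((C.definable_leSet p p).inter (C.definable_leSet q q)).inter
      ((C.definable_leSet (Sum.inl ∘ xa) p).inter
        (C.definable_leSet (Sum.inl ∘ xb) p).compl) using 1
    ext v
    change (v ∘ Fin.castAdd n ∈ C.dom ∧ v ∘ Fin.natAdd n ∈ C.dom) ∧ _ ↔
      ((v ∘ Fin.castAdd n ∈ C.dom ∧ v ∘ Fin.castAdd n ∈ C.dom ∧ _ ≤ _) ∧
        (v ∘ Fin.natAdd n ∈ C.dom ∧ v ∘ Fin.natAdd n ∈ C.dom ∧ _ ≤ _)) ∧
      ((xa ∈ C.dom ∧ v ∘ Fin.castAdd n ∈ C.dom ∧ C.val xa ≤ C.val (v ∘ Fin.castAdd n)) ∧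
        ¬ (xb ∈ C.dom ∧ v ∘ Fin.castAdd n ∈ C.dom ∧ C.val xb ≤ C.val (v ∘ Fin.castAdd n)))
    simp only [hxa, hxb, true_and, le_refl, and_true, and_self]
    constructor
    · rintro ⟨⟨h₁, h₂⟩, h₃, h₄⟩
      exact ⟨⟨h₁, h₂⟩, ⟨h₁, h₃⟩, fun h => h.2.not_gt h₄⟩
    · rintro ⟨⟨h₁, h₂⟩, ⟨-, h₃⟩, h₄⟩
      exact ⟨⟨h₁, h₂⟩, h₃, lt_of_not_ge fun h => h₄ ⟨h₁, h⟩⟩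
  let p (i : Fin 2) (j : Fin n) : M ⊕ Fin 2 × Fin (n + n) := Sum.inr (i, Fin.castAdd n j)
  let q (i : Fin 2) (j : Fin n) : M ⊕ Fin 2 × Fin (n + n) := Sum.inr (i, Fin.natAdd n j)
  have pos_le (x : Fin 2 → X) (i j : Fin 2) :
      (fun p => (x p.1 : Fin (n + n) → M) p.2) ∈ C.leSet (p i) (p j) ↔
        (f (x i)).pos ≤ (f (x j)).pos :=
    ⟨fun h => h.2.2, fun h => ⟨(x i).2.1.1, (x j).2.1.1, h⟩⟩
  have label_le (x : Fin 2 → X) (i j : Fin 2) :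
      (fun p => (x p.1 : Fin (n + n) → M) p.2) ∈ C.leSet (q i) (q j) ↔
        (f (x i)).label ≤ (f (x j)).label :=
    ⟨fun h => h.2.2, fun h => ⟨(x i).2.1.2, (x j).2.1.2, h⟩⟩
  have label_le_c (x : Fin 2 → X) (i : Fin 2) (m : ℕ) (j : ZMod (m + 1)) :
      (fun p => (x p.1 : Fin (n + n) → M) p.2) ∈ C.leSet (q i) (Sum.inl ∘ z m j) ↔
        (f (x i)).label ≤ c m j := by
    rw [← hzc]
    exact ⟨fun h => h.2.2, fun h => ⟨(x i).2.1.2, hz m j, h⟩⟩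
  have c_le_label (x : Fin 2 → X) (i : Fin 2) (m : ℕ) (j : ZMod (m + 1)) :
      (fun p => (x p.1 : Fin (n + n) → M) p.2) ∈ C.leSet (Sum.inl ∘ z m j) (q i) ↔
        c m j ≤ (f (x i)).label := by
    rw [← hzc]
    exact ⟨fun h => h.2.2, fun h => ⟨hz m j, (x i).2.1.2, h⟩⟩
  refine ⟨n + n, X, f, ?_, hX, ?_, ?_, fun _ F => F.elim⟩
  · rintro ⟨⟨y, hy⟩, l⟩
    obtain ⟨v, hv, rfl⟩ := C.surj y
    obtain ⟨w, hw, rfl⟩ := C.surj l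
    have e₁ : Fin.append v w ∘ Fin.castAdd n = v := funext fun i => Fin.append_left v w i
    have e₂ : Fin.append v w ∘ Fin.natAdd n = w := funext fun i => Fin.append_right v w i
    refine ⟨⟨Fin.append v w, ?_⟩, ?_⟩
    · simp only [X, mem_ofPred_eq, e₁, e₂]
      exact ⟨⟨hv, hw⟩, hy⟩
    · simp only [f, e₁, e₂]
  · refine definable_pullback hX f (((C.definable_leSet (p 0) (p 1)).inter
      (C.definable_leSet (p 1) (p 0))).inter ((C.definable_leSet (q 0) (q 1)).inter
      (C.definable_leSet (q 1) (q 0)))) fun x => ?_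
    rw [mem_inter_iff, mem_inter_iff, mem_inter_iff, pos_le, pos_le, label_le, label_le,
      ← le_antisymm_iff, ← le_antisymm_iff]
    exact Circles.ext_iff.symm
  · rintro _ ⟨m⟩
    have isLabel (i : Fin 2) (j : ZMod (m + 1)) : ∃ Q : Set (Fin 2 × Fin (n + n) → M),
        (univ : Set M).Definable L Q ∧ ∀ x : Fin 2 → X,
          (fun p => (x p.1 : Fin (n + n) → M) p.2) ∈ Q ↔ (f (x i)).label = c m j :=
      ⟨_, (C.definable_leSet (q i) (Sum.inl ∘ z m j)).inter
        (C.definable_leSet (Sum.inl ∘ z m j) (q i)), fun x => by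
          rw [mem_inter_iff, label_le_c, c_le_label, ← le_antisymm_iff]⟩
    choose Q hQ hQl using isLabel
    have const (r : Prop) : (univ : Set M).Definable L {_v : Fin 2 × Fin (n + n) → M | r} := by
      by_cases hr : r
      · simpa only [hr, ofPred_true] using definable_univ
      · simpa only [hr, ofPred_false] using definable_empty
    refine definable_pullback hX f (definable_iUnion_of_finite fun i : ZMod (m + 1) =>
      definable_iUnion_of_finite fun j : ZMod (m + 1) => (hQ 0 i).inter ((hQ 1 j).inter
        (((const (i = j)).inter (C.definable_leSet (p 0) (p 1))).union
          ((const (j = i + 1)).inter (C.definable_leSet (p 0) (p 1)).compl)))) fun x => ?_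
    simp only [mem_iUnion, mem_inter_iff, mem_union, mem_compl_iff, hQl, pos_le, not_le,
      mem_ofPred_eq]
    exact Iff.rfl

end

/-! ### Non-G-compactness from an interpreted order, and the theorem. -/

section

/-- The interval `[a, c)` is the ordered sum of `[a, b)` and `[b, c)`, and all three have the same
types. -/
theorem isIdempotentOrder_Ico {K : Type u} [LinearOrder K] {a b c : K} (hab : a ≤ b) (hbc : b ≤ c)
    (h : ∀ m, efType m (Ico a b) = efType m (Ico a c) ∧ efType m (Ico b c) = efType m (Ico a c)) :
    IsIdempotentOrder (Ico a b) := by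
  have e (m : ℕ) : efType m (univ : Set (Ico a b)) = efType m (Ico a b) := by
    rw [← efType_image (Subtype.strictMono_coe (· ∈ Ico a b)), image_univ, Subtype.range_coe]
  intro m γ _ s t hst hs ht
  rw [e] at hs ht ⊢
  rw [(h m).1, ← Ico_union_Ico_eq_Ico hab hbc]
  exact efType_union hst (fun x hx y hy => hx.2.trans_le hy.1) hs
    (ht.trans ((h m).1.trans (h m).2.symm))

theorem exists_labelsInjective (K : Type u) [Infinite K] :
    ∃ c : (n : ℕ) → ZMod (n + 1) → K, LabelsInjective c := by
  obtain ⟨g, hg⟩ := exists_injective_nat (Σ n : ℕ, ZMod (n + 1))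
  exact ⟨fun n i => Infinite.natEmbedding K (g ⟨n, i⟩),
    fun p q h => hg ((Infinite.natEmbedding K).injective h)⟩

/-- A theory that interprets an infinite linear order is not hereditarily G-compact. -/
theorem not_isHereditarilyGCompact {L : FirstOrder.Language.{u, u}} {T : L.Theory}
    (h : InterpretsInfiniteLinearOrder T) : ¬ IsHereditarilyGCompact T := by
  obtain ⟨M, _, _, K, _, hM, _, hK⟩ := h
  intro hT
  obtain ⟨n, ⟨C⟩⟩ := exists_orderCoordinates hK
  -- The idempotent interval may exist only in an ultrapower of `K`. It is interpreted in the
  -- ultrapower of `M`, again a model of `T`.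
  obtain ⟨C⟩ := C.ultrapower (hyperfilter ℕ)
  obtain ⟨a, b, c, hab, hbc, hm⟩ := exists_germ_efType_Ico_eq (α := K)
  have : Infinite ((hyperfilter ℕ : Filter ℕ).Germ K) :=
    Infinite.of_injective (fun x : K => ((fun _ => x : ℕ → K) : (hyperfilter ℕ : Filter ℕ).Germ K))
      fun x y h => Germ.const_inj.1 h
  obtain ⟨l, hl⟩ := exists_labelsInjective ((hyperfilter ℕ : Filter ℕ).Germ K)
  have : Nonempty (Ico a b) := ⟨⟨a, le_rfl, hab⟩⟩
  have hU : ((hyperfilter ℕ : Filter ℕ).Product fun _ => M) ⊨ T := by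
    refine Theory.model_iff _ |>.2 fun φ hφ => ?_
    exact (Ultraproduct.sentence_realize φ).2 (Eventually.of_forall fun _ =>
      Theory.realize_sentence_of_mem T hφ)
  have : Nonempty (Circles (Ico a b) l) := ⟨⟨Classical.arbitrary _, a⟩⟩
  exact not_isGCompact (isIdempotentOrder_Ico hab.le hbc.le hm) hl
    (hT _ hU _ _ (interprets_circles C a b l))

theorem formulaOP_of_formulaSOP {L : FirstOrder.Language.{u, u}} {M : Type u}
    [L.Structure M] [Nonempty M] {m n : ℕ} {φ : L.Formula (Fin m ⊕ Fin n)}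
    (h : FormulaSOP M φ) : FormulaOP M φ := by
  obtain ⟨b, hb⟩ := h
  -- The witness `a i` lies in the set of index `i + 1` and not in that of index `i`.
  choose a ha ha' using fun i => exists_of_ssubset (hb i (i + 1) i.lt_succ_self)
  refine ⟨a, b, fun i j => ⟨fun hφ => ?_, fun hij => ?_⟩⟩
  · by_contra! hij
    refine ha' i ?_
    rcases hij.eq_or_lt with rfl | hij
    · exact hφ
    · exact (hb j i hij).subset hφ
  · rcases (Nat.succ_le_of_lt hij).eq_or_lt with rfl | hij
    · exact ha i
    · exact (hb _ _ hij).subset (ha i)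

end

end OrderInterpretation

theorem mainTheorem6
    (conjecture : ∀ (L : FirstOrder.Language.{u, u}) (T : L.Theory), T.IsComplete →
      IsUnstable T → IsNIP T → InterpretsInfiniteLinearOrder T)
    (L : FirstOrder.Language.{u, u}) (T : L.Theory) (hNIP : IsNIP T) (hSOP : HasSOP T) :
    ¬ IsHereditarilyGCompact T := by
  obtain ⟨M, _, _, m, n, φ, hM, hφ⟩ := hSOP
  -- `T` need not be complete, so the conjecture is applied to the complete theory of `M`, whose
  -- models are models of `T`.
  have model {N : Type u} [L.Structure N] (hN : N ⊨ L.completeTheory M) : N ⊨ T :=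
    hN.mono (FirstOrder.Language.Theory.completeTheory.subset (T := T))
  obtain ⟨N, _, _, K, _, hN, hK⟩ := conjecture L (L.completeTheory M)
    (FirstOrder.Language.completeTheory.isComplete L M)
    ⟨M, _, inferInstance, m, n, φ, inferInstance, OrderInterpretation.formulaOP_of_formulaSOP hφ⟩
    fun ⟨N, _, hne, k, l, ψ, hN, hψ⟩ => hNIP ⟨N, _, hne, k, l, ψ, model hN, hψ⟩
  exact OrderInterpretation.not_isHereditarilyGCompact ⟨N, _, inferInstance, K, _, model hN, hK⟩
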